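/- Let $\mathcal S=\{1,\dots,S\}$ be a finite set of local states, $\Delta\subset\mathbb R^{\mathcal S}$ the probability simplex and $\|\cdot\|$ the $1$-norm on $\mathbb R^{\mathcal S}$. For $k,s\in\mathcal S$ let $Q_{ks}:\mathbb R^{\mathcal S}\to\mathbb R$ be locally Lipschitz functions with $Q_{ks}(\varphi)\ge 0$ whenever $k\ne s$ and all coordinates of $\varphi$ are nonnegative, and $Q_{ss}=-\sum_{k\ne s}Q_{ks}$; write $Q=(Q_{ks})$ for the resulting matrix-valued function. **Graph.** For every $N$ let $w^N_{ij}$ and $b^N_{ij}$ ($1\le i<j\le N$) be mutually independent random variables; the $w_{ij}^N$ have a common law on $[0,\infty)$, not depending on $N$, with mean $\mu\in(0,\infty)$ and finite variance, and $b^N_{ij}\in\{0,1\}$ with $\mathbb P(b^N_{ij}=1)=p^N\in[0,1]$. Put $a^N_{ij}=a^N_{ji}=w^N_{ij}b^N_{ij}$ for $i<j$, $a^N_{ii}=0$, and let $\langle d\rangle=(N-1)p^N\mu$ be the average weighted degree. $G^N$ denotes the weighted graph $(a_{ij}^N)$. **Process.** Conditionally on $G^N$, the states of the $N$ vertices form a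 continuous-time Markov chain on $\mathcal S^N$ with càdlàg paths, in which vertex $i$ jumps from state $s$ to state $k\ne s$ at rate $Q_{ks}(\phi^N_i(t))$, where $$\phi_i^N(t)=\frac1{\langle d\rangle}\sum_{j=1}^N a^N_{ij}\,\xi_j^N(t)$$ and $\xi_j^N(t)=(\xi^N_{s,j}(t))_{s\in\mathcal S}$ is the indicator vector of the state of vertex $j$ at time $t$. The initial states may be random and may depend on $G^N$. Put $x^N(t)=\frac1N\sum_{i=1}^N\xi_i^N(t)$. **NIMFA.** Let $z_1^N,\dots,z_N^N$ be the solution on $[0,\infty)$ of $$\dot z_i^N(t)=Q(\rho_i^N(t))\,z_i^N(t),\qquad \rho_i^N(t)=\frac1{\langle d\rangle}\sum_{j=1}^N a_{ij}^N z_j^N(t),\qquad z_i^N(0)\in\Delta,$$ with possibly random initial values, and put $y^N(t)=\frac1N\sum_{i=1}^N z_i^N(t)$. **Homogeneous mean field.** Let $u$ be the solution on $[0,\infty)$ of $\dot u(t)=Q(u(t))u(t)$ with $u(0)\in\Delta$. Assume that $x^N(0)\to u(0)$ and $y^N(0)\to u(0)$ in probability as $N\to\infty$, and that one of the following two pairs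 of conditions holds: * (A1) every $Q_{ks}$ is globally Lipschitz on $\mathbb R^{\mathcal S}$, and (A2) there are constants $c,\epsilon>0$ with $\langle d\rangle\ge cN^{1/2+\epsilon}$ for all sufficiently large $N$; or * (B1) $p^N=1$ for all $N$, and (B2) $\mathbb E\exp(\theta w^N_{12})<\infty$ for some $\theta>0$. Then for every $T>0$, as $N\to\infty$, $$\sup_{0\le t\le T}\|x^N(t)-u(t)\|\to 0\quad\text{and}\quad \sup_{0\le t\le T}\|y^N(t)-u(t)\|\to 0\quad\text{in probability.}$$ -/

import Mathlib

open MeasureTheory ProbabilityTheory Filter Topology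
open scoped ENNReal Matrix

noncomputable section

namespace MeanField

/-- Unordered pairs of distinct vertices, written as ordered pairs `i < j`. -/
abbrev Edge (N : ℕ) : Type := {e : Fin N × Fin N // e.1 < e.2}

/-- A global configuration: the local state of every vertex. -/
abbrev Config (N S : ℕ) : Type := Fin N → Fin S

/-- The weighted adjacency matrix `a i j = w i j * b i j`, symmetric with zero diagonal,
built from the link weights `w` and the link indicators `b`. -/
def adj {N : ℕ} (w b : Edge N → ℝ) (i j : Fin N) : ℝ :=
  if h : i < j then w ⟨(i, j), h⟩ * b ⟨(i, j), h⟩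
  else if h : j < i then w ⟨(j, i), h⟩ * b ⟨(j, i), h⟩
  else 0

/-- The average degree `⟨d⟩ = (N - 1) p μ`. -/
def avgDegree (N : ℕ) (p μ : ℝ) : ℝ := ((N : ℝ) - 1) * (p * μ)

/-- The random variables `w e`, `b e` form a weighted Erdős–Rényi graph: all of them are
mutually independent, the weights have law `ν`, and `b e` is the indicator of an event of
probability `p`. -/
structure IsWeightedErdosRenyi {Ω : Type*} [MeasurableSpace Ω] (P : Measure Ω) {N : ℕ}
    (ν : Measure ℝ) (p : ℝ) (w b : Edge N → Ω → ℝ) : Prop where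
  p_mem : p ∈ Set.Icc (0 : ℝ) 1
  measurable_w : ∀ e, Measurable (w e)
  measurable_b : ∀ e, Measurable (b e)
  law_w : ∀ e, P.map (w e) = ν
  b_zero_or_one : ∀ e, ∀ᵐ ω ∂P, b e ω = 0 ∨ b e ω = 1
  prob_b : ∀ e, P {ω | b e ω = 1} = ENNReal.ofReal p
  indep : iIndepFun (Sum.elim w b : Edge N ⊕ Edge N → Ω → ℝ) P

/-- `Q φ k s` is the rate of a transition from `s` to `k` in the environment `φ`: it is
nonnegative for `k ≠ s` in every environment with nonnegative coordinates, and the diagonal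
entries are given by the usual convention. -/
structure IsRateFunction {S : ℕ} (Q : (Fin S → ℝ) → Matrix (Fin S) (Fin S) ℝ) : Prop where
  nonneg : ∀ φ : Fin S → ℝ, (∀ s, 0 ≤ φ s) → ∀ k s, k ≠ s → 0 ≤ Q φ k s
  diag : ∀ φ s, Q φ s s = -∑ k ∈ Finset.univ.erase s, Q φ k s

/-- The environment of vertex `i`: `(1 / d) ∑ j, a i j • v j`. -/
def environment {N S : ℕ} (d : ℝ) (a : Fin N → Fin N → ℝ) (v : Fin N → Fin S → ℝ)
    (i : Fin N) : Fin S → ℝ :=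
  d⁻¹ • ∑ j, a i j • v j

/-- The average of the vectors attached to the vertices. -/
def average {N S : ℕ} (v : Fin N → Fin S → ℝ) : Fin S → ℝ :=
  (N : ℝ)⁻¹ • ∑ i, v i

/-- The indicator vectors `ξ_{s,i}` of a configuration. -/
def indicators {N S : ℕ} (η : Config N S) (i : Fin N) : Fin S → ℝ :=
  fun s => if η i = s then 1 else 0

/-- The generator of the exact system on the graph `a`: the entry at `(η, η')` is the rate of
the jump from `η` to `η'`. Only one vertex changes its state at a time, and vertex `i` jumps
from `η i` to `k` at rate `Q φ_i k (η i)`. On the diagonal the sum runs over all vertices and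
gives minus the total jump rate out of `η`. -/
def generator {N S : ℕ} (Q : (Fin S → ℝ) → Matrix (Fin S) (Fin S) ℝ) (d : ℝ)
    (a : Fin N → Fin N → ℝ) : Matrix (Config N S) (Config N S) ℝ :=
  fun η η' => ∑ i, if ∀ j, j ≠ i → η' j = η j
    then Q (environment d a (indicators η) i) (η' i) (η i) else 0

/-- The σ-algebra generated by the graph and by the process up to time `r`. -/
@[reducible] def history {Ω : Type*} {N S : ℕ} (a : Ω → Fin N → Fin N → ℝ) (ξ : ℝ → Ω → Config N S)
    (r : ℝ) : MeasurableSpace Ω :=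
  MeasurableSpace.comap a inferInstance ⊔
    ⨆ q ∈ Set.Icc (0 : ℝ) r, MeasurableSpace.comap (ξ q) inferInstance

/-- `ξ` is a local density-dependent Markov process in the random environment `a`:
conditionally on the graph it is a continuous-time Markov chain with the transition semigroup
`exp (t • generator)`, and almost all of its paths are càdlàg (for the discrete topology). -/
structure IsLocalDensityProcess {Ω : Type*} [MeasurableSpace Ω] (P : Measure Ω) {N S : ℕ}
    (Q : (Fin S → ℝ) → Matrix (Fin S) (Fin S) ℝ) (d : ℝ) (a : Ω → Fin N → Fin N → ℝ)
    (ξ : ℝ → Ω → Config N S) : Prop where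
  measurable : ∀ t, 0 ≤ t → Measurable (ξ t)
  right_cont : ∀ᵐ ω ∂P, ∀ t, 0 ≤ t → ∀ᶠ r in 𝓝[>] t, ξ r ω = ξ t ω
  left_lim : ∀ᵐ ω ∂P, ∀ t, 0 < t → ∃ η, ∀ᶠ r in 𝓝[<] t, ξ r ω = η
  markov : ∀ r t, 0 ≤ r → r ≤ t → ∀ η : Config N S,
    P[Set.indicator {ω | ξ t ω = η} (fun _ => (1 : ℝ)) | history a ξ r] =ᵐ[P]
      fun ω => NormedSpace.exp ((t - r) • generator Q d (a ω)) (ξ r ω) η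

/-- `z` solves the NIMFA system on the graph `a`, from initial values in the simplex. -/
structure IsNIMFA {N S : ℕ} (Q : (Fin S → ℝ) → Matrix (Fin S) (Fin S) ℝ) (d : ℝ)
    (a : Fin N → Fin N → ℝ) (z : ℝ → Fin N → Fin S → ℝ) : Prop where
  init : ∀ i, z 0 i ∈ stdSimplex ℝ (Fin S)
  ode : ∀ t, 0 ≤ t → ∀ i, HasDerivWithinAt (fun r => z r i)
    (Q (environment d a (z t) i) *ᵥ z t i) (Set.Ici 0) t

/-- `u` solves the homogeneous mean-field equation, from an initial value in the simplex. -/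
structure IsMeanFieldSolution {S : ℕ} (Q : (Fin S → ℝ) → Matrix (Fin S) (Fin S) ℝ)
    (u : ℝ → Fin S → ℝ) : Prop where
  init : u 0 ∈ stdSimplex ℝ (Fin S)
  ode : ∀ t, 0 ≤ t → HasDerivWithinAt u (Q (u t) *ᵥ u t) (Set.Ici 0) t

/-- The distance of two vectors in the 1-norm. -/
def dist1 {S : ℕ} (v v' : Fin S → ℝ) : ℝ≥0∞ := ENNReal.ofReal (∑ s, |v s - v' s|)

/-- The uniform distance on `[0, T]` of two vector-valued functions. -/
def supDist {S : ℕ} (T : ℝ) (v v' : ℝ → Fin S → ℝ) : ℝ≥0∞ :=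
  ⨆ t ∈ Set.Icc (0 : ℝ) T, dist1 (v t) (v' t)

/-- Convergence to zero in probability of nonnegative variables `Z N`, each defined on its own
probability space. -/
def TendstoZeroInProbability {Ω : ℕ → Type*} [∀ N, MeasurableSpace (Ω N)]
    (P : ∀ N, Measure (Ω N)) (Z : ∀ N, Ω N → ℝ≥0∞) : Prop :=
  ∀ ε : ℝ≥0∞, 0 < ε → Tendsto (fun N => P N {ω | ε ≤ Z N ω}) atTop (𝓝 0)

end MeanField

end

open MeanField

-- If every vertex saw the global average instead of its own environment, the average drift would be
-- exactly `Q x *ᵥ x`, the closed equation for `u`. Where the rates are Lipschitz, this replacement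
-- costs at most a constant times `deviation`, the mean distance of the environments from the
-- average. It therefore has to be shown that `deviation` is small for all families of simplex
-- vectors simultaneously: the states and the initial values may depend on the graph, so a bound for
-- one fixed family would not do.
--
-- Up to O(1/N), `deviation` is controlled coordinatewise by the mean of |(Mv)_i|, with M the
-- centred adjacency matrix divided by ⟨d⟩. Since |v_j| ≤ 1, ‖Mv‖² is at most the trace of MᵀM plus
-- the sum of its absolute off-diagonal entries (`sq_sum_mulVec_le`), and v has disappeared. The
-- entries of M are centred with second moment V = O(1/(N²p)). The trace has mean at most N²V, to be
-- compared with N, and the squared off-diagonal entries sum to at most N³V² = O(1/(Np²)) in mean,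
-- because for fixed columns the products are pairwise independent. So `deviation` vanishes in
-- probability as soon as Np² → ∞ (`prob_not_nearlyHomogeneous`, `deviation_le`). This follows from
-- (A2), and also from p = 1. A Lipschitz constant is given by (A1); under (B) a Chernoff bound
-- keeps all degrees below K⟨d⟩ (`prob_large_degree`), so that the environments stay in a compact
-- box.
--
-- On the good graphs NIMFA is handled by Grönwall's inequality (`IsNIMFA.norm_average_sub_le`). The
-- chain is observed on a time grid: the conditional mean and variance of its increments come from
-- exp(hG) = 1 + hG + o(h), the centred increments form a martingale with variance O(T/N), and
-- Kolmogorov's inequality is combined with a discrete Grönwall lemma (`prob_grid_le`). The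
-- resulting bound does not depend on the mesh, so right-continuity carries it to all times
-- (`prob_exists_le`). Everything is put together in `tendstoZeroInProbability_of_lipschitzRates`.

namespace MeanField

-- Preliminaries on rates, environments and averages

theorem IsRateFunction.sum_col {S : ℕ} {Q : (Fin S → ℝ) → Matrix (Fin S) (Fin S) ℝ}
    (hQ : IsRateFunction Q) (φ : Fin S → ℝ) (s : Fin S) : ∑ k, Q φ k s = 0 := by
  rw [← Finset.add_sum_erase _ _ (Finset.mem_univ s), hQ.diag]
  ring

/-- Squaring removes the kink of the negative part at 0. This makes the functional of the positivity
argument in `IsNIMFA.nonneg` differentiable. -/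
theorem hasDerivAt_min_zero_sq (x : ℝ) :
    HasDerivAt (fun y : ℝ => (min y 0) ^ 2) (2 * min x 0) x := by
  rcases lt_trichotomy x 0 with hx | rfl | hx
  · have h : (fun y : ℝ => (min y 0) ^ 2) =ᶠ[𝓝 x] fun y => y ^ 2 := by
      filter_upwards [gt_mem_nhds hx] with y hy
      rw [min_eq_left hy.le]
    rw [min_eq_left hx.le]
    simpa using (hasDerivAt_pow 2 x).congr_of_eventuallyEq h
  · have : HasFDerivAt (fun y : ℝ => (min y 0) ^ 2) (0 : ℝ →L[ℝ] ℝ) 0 := by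
      refine Asymptotics.IsBigO.hasFDerivAt (n := 2) ?_ one_lt_two
      refine Asymptotics.IsBigO.of_bound 1 (Eventually.of_forall fun y => ?_)
      rw [one_mul, sub_zero, norm_pow, norm_pow, norm_norm]
      gcongr
      rcases le_total y 0 with h | h <;> simp [h]
    simpa using this.hasDerivAt
  · have h : (fun y : ℝ => (min y 0) ^ 2) =ᶠ[𝓝 x] fun _ => 0 := by
      filter_upwards [lt_mem_nhds hx] with y hy
      rw [min_eq_right hy.le]; simp
    rw [min_eq_right hx.le, mul_zero]
    exact (hasDerivAt_const x (0 : ℝ)).congr_of_eventuallyEq h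

theorem nonpos_of_deriv_right_le {f f' : ℝ → ℝ} {K T : ℝ} (hf : ContinuousOn f (Set.Icc 0 T))
    (hd : ∀ t ∈ Set.Ico 0 T, HasDerivWithinAt f (f' t) (Set.Ici t) t) (h0 : f 0 ≤ 0)
    (hle : ∀ t ∈ Set.Ico 0 T, f' t ≤ K * f t) : ∀ t ∈ Set.Icc 0 T, f t ≤ 0 := by
  intro t ht
  have := le_gronwallBound_of_liminf_deriv_right_le (δ := 0) (K := K) (ε := 0) hf
    (fun x hx r hr => (hd x hx).liminf_right_slope_le hr) h0 (by simpa using hle) t ht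
  rwa [gronwallBound_ε0_δ0] at this

/-- The rates are `L`-Lipschitz on the set `D`. -/
def LipschitzRates {S : ℕ} (Q : (Fin S → ℝ) → Matrix (Fin S) (Fin S) ℝ) (D : Set (Fin S → ℝ))
    (L : ℝ) : Prop :=
  ∀ k s, ∀ φ ∈ D, ∀ ψ ∈ D, |Q φ k s - Q ψ k s| ≤ L * ‖φ - ψ‖

theorem exists_lipschitzRates {S : ℕ} {Q : (Fin S → ℝ) → Matrix (Fin S) (Fin S) ℝ}
    {D : Set (Fin S → ℝ)} (h : ∀ k s, ∃ K, LipschitzOnWith K (fun φ => Q φ k s) D) :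
    ∃ L : ℝ, 0 ≤ L ∧ LipschitzRates Q D L := by
  choose K hK using h
  refine ⟨∑ k, ∑ s, (K k s : ℝ), by positivity, fun k s φ hφ ψ hψ => ?_⟩
  have h1 := (hK k s).dist_le_mul φ hφ ψ hψ
  rw [Real.dist_eq, dist_eq_norm] at h1
  refine h1.trans ?_
  gcongr
  calc (K k s : ℝ) ≤ ∑ s, (K k s : ℝ) :=
        Finset.single_le_sum (f := fun s => (K k s : ℝ)) (fun _ _ => by positivity)
          (Finset.mem_univ s)
    _ ≤ _ := Finset.single_le_sum (f := fun k => ∑ s, (K k s : ℝ)) (fun _ _ => by positivity)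
          (Finset.mem_univ k)

/-- Locally Lipschitz rates are Lipschitz on compact sets, with a common constant. -/
theorem exists_lipschitzRates_of_isCompact {S : ℕ}
    {Q : (Fin S → ℝ) → Matrix (Fin S) (Fin S) ℝ} (hQlip : ∀ k s, LocallyLipschitz fun φ => Q φ k s)
    {D : Set (Fin S → ℝ)} (hD : IsCompact D) : ∃ L : ℝ, 0 ≤ L ∧ LipschitzRates Q D L :=
  exists_lipschitzRates fun k s =>
    ((hQlip k s).locallyLipschitzOn (s := D)).exists_lipschitzOnWith_of_compact hD

theorem exists_bound_of_isCompact {S : ℕ} {Q : (Fin S → ℝ) → Matrix (Fin S) (Fin S) ℝ}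
    (hQlip : ∀ k s, LocallyLipschitz fun φ => Q φ k s) {D : Set (Fin S → ℝ)} (hD : IsCompact D) :
    ∃ B : ℝ, 0 ≤ B ∧ ∀ k s, ∀ φ ∈ D, |Q φ k s| ≤ B := by
  have h : ∀ k s, ∃ B : ℝ, ∀ φ ∈ D, ‖Q φ k s‖ ≤ B := fun k s =>
    hD.exists_bound_of_continuousOn (hQlip k s).continuous.continuousOn
  choose B hB using h
  refine ⟨∑ k, ∑ s, |B k s|, by positivity, fun k s φ hφ => ?_⟩
  calc |Q φ k s| ≤ |B k s| := (hB k s φ hφ).trans (le_abs_self _)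
    _ ≤ ∑ s, |B k s| :=
        Finset.single_le_sum (f := fun s => |B k s|) (fun _ _ => by positivity)
          (Finset.mem_univ s)
    _ ≤ _ := Finset.single_le_sum (f := fun k => ∑ s, |B k s|) (fun _ _ => by positivity)
          (Finset.mem_univ k)

theorem environment_apply {N S : ℕ} (d : ℝ) (a : Fin N → Fin N → ℝ) (v : Fin N → Fin S → ℝ)
    (i : Fin N) (s : Fin S) : environment d a v i s = d⁻¹ * ∑ j, a i j * v j s := by
  simp [environment]

theorem average_apply {N S : ℕ} (v : Fin N → Fin S → ℝ) (s : Fin S) :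
    average v s = (N : ℝ)⁻¹ * ∑ i, v i s := by
  simp [average]

theorem environment_sub {N S : ℕ} (d : ℝ) (a : Fin N → Fin N → ℝ) (v v' : Fin N → Fin S → ℝ)
    (i : Fin N) : environment d a (v - v') i = environment d a v i - environment d a v' i := by
  ext s
  simp [environment_apply, mul_sub]

theorem environment_nonneg {N S : ℕ} {d : ℝ} {a : Fin N → Fin N → ℝ} {v : Fin N → Fin S → ℝ}
    (hd : 0 ≤ d) (ha : ∀ i j, 0 ≤ a i j) (hv : ∀ j s, 0 ≤ v j s) (i : Fin N) (s : Fin S) :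
    0 ≤ environment d a v i s := by
  rw [environment_apply]
  exact mul_nonneg (inv_nonneg.2 hd)
    (Finset.sum_nonneg fun j _ => mul_nonneg (ha i j) (hv j s))

/-- The constant depends on the whole graph and may grow with N. It serves only to confine the
environments to a ball in compactness arguments at fixed N. -/
theorem norm_environment_le {N S : ℕ} (d : ℝ) (a : Fin N → Fin N → ℝ) (v : Fin N → Fin S → ℝ)
    (i : Fin N) : ‖environment d a v i‖ ≤ |d⁻¹| * (∑ i, ∑ j, |a i j|) * ‖v‖ := by
  refine (pi_norm_le_iff_of_nonneg (by positivity)).2 fun s => ?_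
  rw [environment_apply, Real.norm_eq_abs, abs_mul, mul_assoc]
  gcongr
  calc |∑ j, a i j * v j s| ≤ ∑ j, |a i j * v j s| := Finset.abs_sum_le_sum_abs _ _
    _ ≤ ∑ j, |a i j| * ‖v‖ := by
        gcongr with j
        rw [abs_mul]
        gcongr
        exact (norm_le_pi_norm (v j) s).trans (norm_le_pi_norm v j)
    _ = (∑ j, |a i j|) * ‖v‖ := by rw [Finset.sum_mul]
    _ ≤ _ := mul_le_mul_of_nonneg_right
        (Finset.single_le_sum (f := fun i => ∑ j, |a i j|) (fun _ _ => by positivity)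
          (Finset.mem_univ i)) (norm_nonneg _)

-- Invariance of the simplex under NIMFA and the mean-field equation

section NIMFA

variable {N S : ℕ} {Q : (Fin S → ℝ) → Matrix (Fin S) (Fin S) ℝ} {d : ℝ}
  {a : Fin N → Fin N → ℝ} {z : ℝ → Fin N → Fin S → ℝ}

theorem IsNIMFA.hasDerivWithinAt (hz : IsNIMFA Q d a z) {t : ℝ} (ht : 0 ≤ t) (i : Fin N)
    (s : Fin S) : HasDerivWithinAt (fun r => z r i s)
      ((Q (environment d a (z t) i) *ᵥ z t i) s) (Set.Ici 0) t :=
  hasDerivWithinAt_pi.1 (hz.ode t ht i) s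

theorem IsNIMFA.continuousOn (hz : IsNIMFA Q d a z) : ContinuousOn z (Set.Ici 0) :=
  continuousOn_pi.2 fun i t ht => (hz.ode t ht i).continuousWithinAt

theorem IsNIMFA.sum_eq_one (hQ : IsRateFunction Q) (hz : IsNIMFA Q d a z) {t : ℝ} (ht : 0 ≤ t)
    (i : Fin N) : ∑ s, z t i s = 1 := by
  have hd : ∀ r, 0 ≤ r → HasDerivWithinAt (fun r => ∑ s, z r i s) 0 (Set.Ici 0) r := by
    intro r hr
    have h := HasDerivWithinAt.fun_sum (u := Finset.univ)
      fun s _ => hz.hasDerivWithinAt hr i s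
    have e : ∑ s, (Q (environment d a (z r) i) *ᵥ z r i) s = 0 := by
      simp only [Matrix.mulVec, dotProduct]
      rw [Finset.sum_comm]
      simp [← Finset.sum_mul, hQ.sum_col]
    rwa [e] at h
  have := constant_of_has_deriv_right_zero (a := 0) (b := t)
    (f := fun r => ∑ s, z r i s)
    (fun r hr => ((hd r hr.1).continuousWithinAt).mono Set.Icc_subset_Ici_self)
    (fun r hr => (hd r hr.1).mono (Set.Ici_subset_Ici.2 hr.1)) t ⟨ht, le_rfl⟩
  exact this.trans (hz.init i).2

/-- The sum f of the squared negative parts starts at 0 and satisfies f' ≤ K f, so it vanishes. The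
difficulty is that off-diagonal rates are known to be nonnegative only in nonnegative environments.
The environment of z is therefore compared with that of its positive part z - m, at a Lipschitz cost
of order ‖m‖. -/
theorem IsNIMFA.nonneg (hQ : IsRateFunction Q)
    (hQlip : ∀ k s, LocallyLipschitz fun φ => Q φ k s) (hd : 0 ≤ d) (ha : ∀ i j, 0 ≤ a i j)
    (hz : IsNIMFA Q d a z) {T : ℝ} (hT : 0 ≤ T) (i : Fin N) (s : Fin S) : 0 ≤ z T i s := by
  set m : ℝ → Fin N → Fin S → ℝ := fun t i s => min (z t i s) 0 with hm
  set A : ℝ := |d⁻¹| * ∑ i, ∑ j, |a i j| with hA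
  have hA0 : 0 ≤ A := by positivity
  obtain ⟨Z, hZ⟩ := isCompact_Icc.exists_bound_of_continuousOn
    (hz.continuousOn.mono (Set.Icc_subset_Ici_self : Set.Icc 0 T ⊆ _))
  have hZ0 : 0 ≤ Z := (norm_nonneg _).trans (hZ 0 ⟨le_rfl, hT⟩)
  -- On [0, T] this ball contains the environments of both z and its positive part.
  obtain ⟨L, hL0, hL⟩ := exists_lipschitzRates_of_isCompact hQlip
    (isCompact_closedBall (0 : Fin S → ℝ) (A * Z))
  obtain ⟨B, hB0, hB⟩ := exists_bound_of_isCompact hQlip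
    (isCompact_closedBall (0 : Fin S → ℝ) (A * Z))
  have hmle : ∀ t i s, |m t i s| ≤ ‖m t‖ := fun t i s =>
    (norm_le_pi_norm (m t i) s).trans (norm_le_pi_norm (m t) i)
  have hzle : ∀ t ∈ Set.Icc 0 T, ∀ i s, |z t i s| ≤ Z := fun t ht i s =>
    ((norm_le_pi_norm (z t i) s).trans (norm_le_pi_norm (z t) i)).trans (hZ t ht)
  have hplus : ∀ t i s, (z t - m t) i s = max (z t i s) 0 := fun t i s => by
    simp only [hm, Pi.sub_apply]
    rcases le_total (z t i s) 0 with h | h <;> simp [h]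
  have hplusle : ∀ t ∈ Set.Icc 0 T, ‖z t - m t‖ ≤ Z := fun t ht => by
    refine (pi_norm_le_iff_of_nonneg hZ0).2 fun i => (pi_norm_le_iff_of_nonneg hZ0).2 fun s => ?_
    rw [hplus, Real.norm_eq_abs, abs_of_nonneg (le_max_right _ _)]
    exact max_le ((le_abs_self _).trans (hzle t ht i s)) hZ0
  set C : ℝ := B + L * A * Z with hC
  have hC0 : 0 ≤ C := by positivity
  have hterm : ∀ t ∈ Set.Icc 0 T, ∀ i s k,
      m t i s * (Q (environment d a (z t) i) s k * z t i k) ≤ C * ‖m t‖ ^ 2 := by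
    intro t ht i s k
    have hρ : environment d a (z t) i ∈ Metric.closedBall (0 : Fin S → ℝ) (A * Z) := by
      rw [mem_closedBall_zero_iff]
      exact (norm_environment_le d a _ i).trans (by gcongr; exact hZ t ht)
    have hρ' : environment d a (z t - m t) i ∈ Metric.closedBall (0 : Fin S → ℝ) (A * Z) := by
      rw [mem_closedBall_zero_iff]
      exact (norm_environment_le d a _ i).trans (by gcongr; exact hplusle t ht)
    have hBk := hB s k _ hρ
    have hms : m t i s ≤ 0 := min_le_right _ _
    have hmq : m t i s * (Q (environment d a (z t) i) s k * m t i k) ≤ B * ‖m t‖ ^ 2 := by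
      refine (le_abs_self _).trans ?_
      rw [abs_mul, abs_mul]
      calc _ ≤ ‖m t‖ * (B * ‖m t‖) := by gcongr <;> apply hmle
        _ = _ := by ring
    have hzk : z t i k = m t i k + max (z t i k) 0 := by
      rw [← hplus]; simp
    rcases eq_or_ne s k with rfl | hsk
    -- On the diagonal m z = m², so the sign of the rate is irrelevant.
    · have h1 : m t i s * (Q (environment d a (z t) i) s s * z t i s) =
          m t i s * (Q (environment d a (z t) i) s s * m t i s) := by
        simp only [hm]
        rcases le_total (z t i s) 0 with h | h <;> simp [h]
      rw [h1]
      refine hmq.trans ?_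
      have : 0 ≤ L * A * Z := by positivity
      nlinarith [sq_nonneg ‖m t‖]
    -- The rate is nonnegative in the environment of z - m, hence nonnegative up to O(‖m‖) in that
    -- of z.
    · have hq : -(L * (A * ‖m t‖)) ≤ Q (environment d a (z t) i) s k := by
        have h1 := hL s k _ hρ _ hρ'
        rw [← environment_sub, sub_sub_cancel] at h1
        have h2 := hQ.nonneg (environment d a (z t - m t) i)
          (environment_nonneg hd ha (fun j s => by rw [hplus]; exact le_max_right _ _) i) s k hsk
        have h3 : L * ‖environment d a (m t) i‖ ≤ L * (A * ‖m t‖) := by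
          gcongr
          exact norm_environment_le d a _ i
        have := (abs_le.1 (h1.trans h3)).1
        linarith
      have hmx : 0 ≤ max (z t i k) 0 := le_max_right _ _
      have hmx' : max (z t i k) 0 ≤ Z := max_le ((le_abs_self _).trans (hzle t ht i k)) hZ0
      -- Inflow from a positive coordinate can be negative only through the error O(‖m‖); the factor
      -- m makes this second order.
      have hp : m t i s * (Q (environment d a (z t) i) s k * max (z t i k) 0) ≤
          L * A * Z * ‖m t‖ ^ 2 := by
        have h1 : -(L * (A * ‖m t‖)) * Z ≤ Q (environment d a (z t) i) s k * max (z t i k) 0 := by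
          have h0 : 0 ≤ L * (A * ‖m t‖) := by positivity
          nlinarith
        have h2 : -‖m t‖ ≤ m t i s := (abs_le.1 (hmle t i s)).1
        have h0 : 0 ≤ L * (A * ‖m t‖) * Z := by positivity
        calc m t i s * (Q (environment d a (z t) i) s k * max (z t i k) 0)
            ≤ m t i s * (-(L * (A * ‖m t‖)) * Z) := mul_le_mul_of_nonpos_left h1 hms
          _ = (-m t i s) * (L * (A * ‖m t‖) * Z) := by ring
          _ ≤ ‖m t‖ * (L * (A * ‖m t‖) * Z) := by gcongr; linarith
          _ = _ := by ring
      calc _ = m t i s * (Q (environment d a (z t) i) s k * m t i k) +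
            m t i s * (Q (environment d a (z t) i) s k * max (z t i k) 0) := by
              conv_lhs => rw [hzk]
              ring
        _ ≤ B * ‖m t‖ ^ 2 + L * A * Z * ‖m t‖ ^ 2 := add_le_add hmq hp
        _ = _ := by rw [hC]; ring
  set f : ℝ → ℝ := fun t => ∑ i, ∑ s, (m t i s) ^ 2 with hf
  have hnorm : ∀ t, ‖m t‖ ^ 2 ≤ f t := by
    intro t
    have h0 : 0 ≤ f t := by positivity
    refine (Real.le_sqrt (norm_nonneg _) h0).1 ?_
    refine (pi_norm_le_iff_of_nonneg (Real.sqrt_nonneg _)).2 fun i =>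
      (pi_norm_le_iff_of_nonneg (Real.sqrt_nonneg _)).2 fun s => ?_
    refine Real.le_sqrt_of_sq_le ?_
    rw [Real.norm_eq_abs, sq_abs]
    calc m t i s ^ 2 ≤ ∑ s, m t i s ^ 2 :=
          Finset.single_le_sum (f := fun s => m t i s ^ 2) (fun _ _ => by positivity)
            (Finset.mem_univ s)
      _ ≤ _ := Finset.single_le_sum (f := fun i => ∑ s, m t i s ^ 2) (fun _ _ => by positivity)
            (Finset.mem_univ i)
  have hfd : ∀ t, 0 ≤ t → HasDerivWithinAt f (∑ i, ∑ s, 2 * m t i s *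
      ((Q (environment d a (z t) i) *ᵥ z t i) s)) (Set.Ici 0) t := by
    intro t ht
    refine HasDerivWithinAt.fun_sum fun i _ => HasDerivWithinAt.fun_sum fun s _ => ?_
    exact (hasDerivAt_min_zero_sq (z t i s)).comp_hasDerivWithinAt t (hz.hasDerivWithinAt ht i s)
  -- K counts the N S squares, the factor 2 from differentiating each, and the S terms of each
  -- matrix-vector product.
  have hzero := nonpos_of_deriv_right_le (f := f) (K := N * (S * (2 * (S * C)))) (T := T)
    (fun r hr => ((hfd r hr.1).continuousWithinAt).mono Set.Icc_subset_Ici_self)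
    (fun r hr => (hfd r hr.1).mono (Set.Ici_subset_Ici.2 hr.1))
    (by
      refine le_of_eq (Finset.sum_eq_zero fun i _ => Finset.sum_eq_zero fun s _ => ?_)
      simp [hm, (hz.init i).1 s])
    (fun t ht => by
      have ht' : t ∈ Set.Icc 0 T := ⟨ht.1, ht.2.le⟩
      calc _ ≤ ∑ i : Fin N, ∑ s : Fin S, 2 * (S * (C * f t)) := by
            refine Finset.sum_le_sum fun i _ => Finset.sum_le_sum fun s _ => ?_
            rw [mul_assoc]
            refine mul_le_mul_of_nonneg_left ?_ zero_le_two
            simp only [Matrix.mulVec, dotProduct, Finset.mul_sum]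
            calc _ ≤ ∑ k : Fin S, C * f t := by
                  refine Finset.sum_le_sum fun k _ => (hterm t ht' i s k).trans ?_
                  gcongr
                  exact hnorm t
              _ = _ := by simp
        _ = _ := by simp; ring)
    T ⟨hT, le_rfl⟩
  have hmz : m T i s = 0 := by
    have h1 : ‖m T‖ ^ 2 ≤ 0 := (hnorm T).trans hzero
    have h2 : ‖m T‖ = 0 := by
      have := norm_nonneg (m T)
      nlinarith
    have := hmle T i s
    rw [h2] at this
    exact abs_nonpos_iff.1 this
  exact min_eq_right_iff.1 hmz

theorem IsNIMFA.mem_stdSimplex (hQ : IsRateFunction Q)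
    (hQlip : ∀ k s, LocallyLipschitz fun φ => Q φ k s) (hd : 0 ≤ d) (ha : ∀ i j, 0 ≤ a i j)
    (hz : IsNIMFA Q d a z) {t : ℝ} (ht : 0 ≤ t) (i : Fin N) : z t i ∈ stdSimplex ℝ (Fin S) :=
  ⟨hz.nonneg hQ hQlip hd ha ht i, hz.sum_eq_one hQ ht i⟩

/-- The mean-field equation is the NIMFA system of a single vertex with a loop of weight 1 and d =
1. -/
theorem IsMeanFieldSolution.mem_stdSimplex {u : ℝ → Fin S → ℝ} (hQ : IsRateFunction Q)
    (hQlip : ∀ k s, LocallyLipschitz fun φ => Q φ k s) (hu : IsMeanFieldSolution Q u) {t : ℝ}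
    (ht : 0 ≤ t) : u t ∈ stdSimplex ℝ (Fin S) := by
  have h : IsNIMFA (N := 1) Q 1 (fun _ _ => 1) (fun t _ => u t) :=
    ⟨fun _ => hu.init, fun t ht i => by simpa [environment] using hu.ode t ht⟩
  exact h.mem_stdSimplex hQ hQlip zero_le_one (fun _ _ => zero_le_one) ht 0

end NIMFA

theorem abs_le_one_of_mem_stdSimplex {S : ℕ} {v : Fin S → ℝ} (hv : v ∈ stdSimplex ℝ (Fin S))
    (s : Fin S) : |v s| ≤ 1 := by
  rw [abs_of_nonneg (hv.1 s), ← hv.2]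
  exact Finset.single_le_sum (fun k _ => hv.1 k) (Finset.mem_univ s)

theorem average_mem_stdSimplex {N S : ℕ} (hN : N ≠ 0) {v : Fin N → Fin S → ℝ}
    (hv : ∀ i, v i ∈ stdSimplex ℝ (Fin S)) : average v ∈ stdSimplex ℝ (Fin S) := by
  have hN' : (N : ℝ) ≠ 0 := by exact_mod_cast hN
  refine ⟨fun s => ?_, ?_⟩
  · rw [average_apply]
    exact mul_nonneg (by positivity) (Finset.sum_nonneg fun i _ => (hv i).1 s)
  · simp only [average_apply]
    rw [← Finset.mul_sum, Finset.sum_comm]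
    simp [(hv _).2, hN']

theorem indicators_mem_stdSimplex {N S : ℕ} (η : Config N S) (i : Fin N) :
    indicators η i ∈ stdSimplex ℝ (Fin S) := by
  refine ⟨fun s => ?_, ?_⟩
  · simp only [indicators]
    split_ifs <;> simp
  · simp [indicators]

-- Drift estimates, in the sup norm, and stability of the NIMFA average

theorem norm_mulVec_le_of_entry_le {S : ℕ} {A : Matrix (Fin S) (Fin S) ℝ} {v : Fin S → ℝ} {c r : ℝ}
    (hr : 0 ≤ r) (hc : 0 ≤ c) (hA : ∀ k s, |A k s| ≤ c) (hv : ∀ s, |v s| ≤ r) :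
    ‖A *ᵥ v‖ ≤ S * (c * r) := by
  refine (pi_norm_le_iff_of_nonneg (by positivity)).2 fun s => ?_
  simp only [Matrix.mulVec, dotProduct, Real.norm_eq_abs]
  calc |∑ k, A s k * v k| ≤ ∑ k, |A s k * v k| := Finset.abs_sum_le_sum_abs _ _
    _ ≤ ∑ k : Fin S, c * r := by
        refine Finset.sum_le_sum fun k _ => ?_
        rw [abs_mul]
        exact mul_le_mul (hA s k) (hv k) (abs_nonneg _) hc
    _ = _ := by simp

theorem norm_drift_sub_le {S : ℕ} {Q : (Fin S → ℝ) → Matrix (Fin S) (Fin S) ℝ}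
    {D : Set (Fin S → ℝ)} {L B : ℝ} (hL0 : 0 ≤ L) (hB0 : 0 ≤ B) (hL : LipschitzRates Q D L)
    (hD : stdSimplex ℝ (Fin S) ⊆ D) (hB : ∀ k s, ∀ φ ∈ stdSimplex ℝ (Fin S), |Q φ k s| ≤ B)
    {v v' : Fin S → ℝ} (hv : v ∈ stdSimplex ℝ (Fin S)) (hv' : v' ∈ stdSimplex ℝ (Fin S)) :
    ‖Q v *ᵥ v - Q v' *ᵥ v'‖ ≤ S * (L + B) * ‖v - v'‖ := by
  have h : Q v *ᵥ v - Q v' *ᵥ v' = (Q v - Q v') *ᵥ v + Q v' *ᵥ (v - v') := by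
    rw [Matrix.sub_mulVec, Matrix.mulVec_sub]; abel
  rw [h]
  calc _ ≤ ‖(Q v - Q v') *ᵥ v‖ + ‖Q v' *ᵥ (v - v')‖ := norm_add_le _ _
    _ ≤ S * ((L * ‖v - v'‖) * 1) + S * (B * ‖v - v'‖) := by
        refine add_le_add ?_ ?_
        · exact norm_mulVec_le_of_entry_le zero_le_one (by positivity)
            (fun k s => hL k s v (hD hv) v' (hD hv')) (abs_le_one_of_mem_stdSimplex hv)
        · exact norm_mulVec_le_of_entry_le (norm_nonneg _) hB0
            (fun k s => hB k s v' hv') (fun s => norm_le_pi_norm (v - v') s)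
    _ = _ := by ring

/-- The mean distance of the environments of the vertices from the global average. -/
noncomputable def deviation {N S : ℕ} (d : ℝ) (a : Fin N → Fin N → ℝ) (v : Fin N → Fin S → ℝ) : ℝ :=
  (N : ℝ)⁻¹ * ∑ i, ‖environment d a v i - average v‖

/-- By linearity `Q (average v) *ᵥ average v` is the average of `Q (average v) *ᵥ v i`, so only the
rates differ. The errors enter through their mean over the vertices; single vertices may have
atypical environments. -/
theorem norm_average_drift_sub_le {N S : ℕ} {Q : (Fin S → ℝ) → Matrix (Fin S) (Fin S) ℝ}
    {D : Set (Fin S → ℝ)} {L : ℝ} (hL0 : 0 ≤ L) (hL : LipschitzRates Q D L)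
    (hD : stdSimplex ℝ (Fin S) ⊆ D) {d : ℝ} {a : Fin N → Fin N → ℝ}
    {v : Fin N → Fin S → ℝ} (hN : N ≠ 0) (hv : ∀ i, v i ∈ stdSimplex ℝ (Fin S))
    (hE : ∀ i, environment d a v i ∈ D) :
    ‖average (fun i => Q (environment d a v i) *ᵥ v i) - Q (average v) *ᵥ average v‖ ≤
      S * L * deviation d a v := by
  have h : average (fun i => Q (environment d a v i) *ᵥ v i) - Q (average v) *ᵥ average v =
      (N : ℝ)⁻¹ • ∑ i, (Q (environment d a v i) - Q (average v)) *ᵥ v i := by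
    have : Q (average v) *ᵥ average v = (N : ℝ)⁻¹ • ∑ i, Q (average v) *ᵥ v i := by
      conv_lhs => rw [show average v = (N : ℝ)⁻¹ • ∑ i, v i from rfl]
      rw [Matrix.mulVec_smul, Matrix.mulVec_sum]
      rfl
    rw [this]
    simp only [average, Matrix.sub_mulVec, Finset.sum_sub_distrib, smul_sub]
  rw [h, norm_smul, Real.norm_of_nonneg (by positivity), deviation]
  calc _ ≤ (N : ℝ)⁻¹ * ∑ i, S * ((L * ‖environment d a v i - average v‖) * 1) := by
        gcongr
        refine (norm_sum_le _ _).trans (Finset.sum_le_sum fun i _ => ?_)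
        exact norm_mulVec_le_of_entry_le zero_le_one (by positivity)
          (fun k s => hL k s _ (hE i) _ (hD (average_mem_stdSimplex hN hv)))
          (abs_le_one_of_mem_stdSimplex (hv i))
    _ = _ := by
        simp only [mul_one, ← mul_assoc, ← Finset.mul_sum]; ring

/-- Individual rates need not be bounded uniformly in N when `D` is unbounded, but their mean is.
This suffices for the quadratic variation of the densities, where `σ` is the current configuration.
-/
theorem average_abs_rate_le {N S : ℕ} {Q : (Fin S → ℝ) → Matrix (Fin S) (Fin S) ℝ}
    {D : Set (Fin S → ℝ)} {L B : ℝ} (hL : LipschitzRates Q D L)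
    (hD : stdSimplex ℝ (Fin S) ⊆ D) (hB : ∀ k s, ∀ φ ∈ stdSimplex ℝ (Fin S), |Q φ k s| ≤ B)
    {d : ℝ} {a : Fin N → Fin N → ℝ} {v : Fin N → Fin S → ℝ} (hN : N ≠ 0)
    (hv : ∀ i, v i ∈ stdSimplex ℝ (Fin S)) (hE : ∀ i, environment d a v i ∈ D)
    (σ : Fin N → Fin S) :
    (N : ℝ)⁻¹ * ∑ i, ∑ k, |Q (environment d a v i) k (σ i)| ≤ S * (B + L * deviation d a v) := by
  have hN' : (N : ℝ) ≠ 0 := by exact_mod_cast hN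
  have hav := average_mem_stdSimplex hN hv
  calc _ ≤ (N : ℝ)⁻¹ * ∑ i, ∑ k : Fin S, (B + L * ‖environment d a v i - average v‖) := by
        gcongr with i _ k _
        have h1 := hL k (σ i) _ (hE i) _ (hD hav)
        have h2 := hB k (σ i) _ hav
        have h3 := abs_sub_abs_le_abs_sub (Q (environment d a v i) k (σ i))
          (Q (average v) k (σ i))
        linarith
    _ = _ := by
        simp only [Finset.sum_const, Finset.card_univ, Fintype.card_fin, nsmul_eq_mul,
          ← Finset.mul_sum, Finset.sum_add_distrib, deviation]
        field_simp

/-- From eˣ - 1 ≤ x eˣ; unlike the definition of `gronwallBound`, this form needs no separate case K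
= 0. -/
theorem gronwallBound_le {δ K ε x : ℝ} (hK : 0 ≤ K) (hε : 0 ≤ ε) :
    gronwallBound δ K ε x ≤ (δ + ε * x) * Real.exp (K * x) := by
  rcases hK.eq_or_lt with rfl | hK
  · simp [gronwallBound_K0]
  · rw [gronwallBound_of_K_ne_0 hK.ne', add_mul]
    refine add_le_add le_rfl ?_
    have h1 : Real.exp (K * x) - 1 ≤ K * x * Real.exp (K * x) := by
      have := Real.add_one_le_exp (-(K * x))
      have h2 : Real.exp (-(K * x)) * Real.exp (K * x) = 1 := by
        rw [← Real.exp_add]; simp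
      nlinarith [Real.exp_pos (K * x)]
    calc ε / K * (Real.exp (K * x) - 1) ≤ ε / K * (K * x * Real.exp (K * x)) := by gcongr
      _ = _ := by field_simp

/-- Stability of the NIMFA average around the mean-field solution. -/
theorem IsNIMFA.norm_average_sub_le {N S : ℕ} {Q : (Fin S → ℝ) → Matrix (Fin S) (Fin S) ℝ}
    (hQ : IsRateFunction Q) (hQlip : ∀ k s, LocallyLipschitz fun φ => Q φ k s)
    {D : Set (Fin S → ℝ)} {L B : ℝ} (hL0 : 0 ≤ L) (hB0 : 0 ≤ B) (hL : LipschitzRates Q D L)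
    (hD : stdSimplex ℝ (Fin S) ⊆ D) (hB : ∀ k s, ∀ φ ∈ stdSimplex ℝ (Fin S), |Q φ k s| ≤ B)
    {d : ℝ} {a : Fin N → Fin N → ℝ} {z : ℝ → Fin N → Fin S → ℝ} {u : ℝ → Fin S → ℝ}
    (hN : N ≠ 0) (hd : 0 ≤ d) (ha : ∀ i j, 0 ≤ a i j)
    (hz : IsNIMFA Q d a z) (hu : IsMeanFieldSolution Q u)
    (hE : ∀ v : Fin N → Fin S → ℝ, (∀ i, v i ∈ stdSimplex ℝ (Fin S)) →
      ∀ i, environment d a v i ∈ D) {r δ : ℝ} (hr0 : 0 ≤ r)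
    (hr : ∀ v : Fin N → Fin S → ℝ, (∀ i, v i ∈ stdSimplex ℝ (Fin S)) → deviation d a v ≤ r)
    (hδ : ‖average (z 0) - u 0‖ ≤ δ) {T t : ℝ} (ht : t ∈ Set.Icc 0 T) :
    ‖average (z t) - u t‖ ≤ (δ + S * L * r * T) * Real.exp (S * (L + B) * T) := by
  have hderiv : ∀ t, 0 ≤ t → HasDerivWithinAt (fun t => average (z t) - u t)
      (average (fun i => Q (environment d a (z t) i) *ᵥ z t i) - Q (u t) *ᵥ u t)
      (Set.Ici 0) t := by
    intro t ht
    refine HasDerivWithinAt.sub ?_ (hu.ode t ht)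
    exact (HasDerivWithinAt.fun_sum fun i _ => hz.ode t ht i).const_smul (N : ℝ)⁻¹
  have hδ0 : 0 ≤ δ := (norm_nonneg _).trans hδ
  -- K is the Lipschitz constant of the limiting drift on the simplex, ε the cost of replacing the
  -- environments by the average.
  have key := norm_le_gronwallBound_of_norm_deriv_right_le (a := 0) (b := T)
    (f := fun t => average (z t) - u t) (K := S * (L + B)) (ε := S * L * r) (δ := δ)
    (fun r hr => ((hderiv r hr.1).continuousWithinAt).mono Set.Icc_subset_Ici_self)
    (fun r hr => (hderiv r hr.1).mono (Set.Ici_subset_Ici.2 hr.1)) hδ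
    (fun t ht => by
      have hzt := hz.mem_stdSimplex hQ hQlip hd ha ht.1
      have h1 := norm_average_drift_sub_le hL0 hL hD hN hzt (hE _ hzt)
      have h2 := norm_drift_sub_le hL0 hB0 hL hD hB (average_mem_stdSimplex hN hzt)
        (hu.mem_stdSimplex hQ hQlip ht.1)
      have h3 : S * L * deviation d a (z t) ≤ S * L * r := by
        gcongr
        exact hr _ hzt
      have h4 := norm_sub_le_norm_sub_add_norm_sub
        (average (fun i => Q (environment d a (z t) i) *ᵥ z t i))
        (Q (average (z t)) *ᵥ average (z t)) (Q (u t) *ᵥ u t)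
      linarith) t ht
  rw [sub_zero] at key
  have ht0 : 0 ≤ t := ht.1
  refine key.trans ((gronwallBound_le (by positivity) (by positivity)).trans ?_)
  have hT : 0 ≤ T := ht.1.trans ht.2
  gcongr
  · exact ht.2
  · exact ht.2

-- A bound on the deviation that is uniform in the states

/-- The edge joining two distinct vertices. -/
def edge {N : ℕ} {i j : Fin N} (h : i ≠ j) : Edge N :=
  ⟨(min i j, max i j), by rcases lt_or_gt_of_ne h with h | h <;> simp [h.le, h]⟩

theorem edge_eq_iff {N : ℕ} {i j k l : Fin N} (h : i ≠ j) (h' : k ≠ l) :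
    edge h = edge h' ↔ (i = k ∧ j = l) ∨ (i = l ∧ j = k) := by
  simp only [edge, Subtype.mk.injEq, Prod.mk.injEq]
  rcases lt_or_gt_of_ne h with h | h <;> rcases lt_or_gt_of_ne h' with h' | h' <;>
    simp only [h.le, h'.le, min_eq_left, min_eq_right, max_eq_left, max_eq_right] <;> omega

theorem adj_self {N : ℕ} (w b : Edge N → ℝ) (i : Fin N) : adj w b i i = 0 := by
  simp [adj]

theorem adj_of_ne {N : ℕ} (w b : Edge N → ℝ) {i j : Fin N} (h : i ≠ j) :
    adj w b i j = w (edge h) * b (edge h) := by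
  rcases lt_or_gt_of_ne h with h | h <;> simp [adj, edge, h, h.le, h.not_gt]

theorem adj_nonneg {N : ℕ} {w b : Edge N → ℝ} (h : ∀ e, 0 ≤ w e * b e) (i j : Fin N) :
    0 ≤ adj w b i j := by
  rcases eq_or_ne i j with rfl | hij
  · rw [adj_self]
  · rw [adj_of_ne _ _ hij]
    exact h _

/-- The symmetric matrix with zero diagonal and the off-diagonal entries given by `x`. -/
abbrev symmMatrix {N : ℕ} (x : Edge N → ℝ) : Fin N → Fin N → ℝ := adj x 1

theorem symmMatrix_of_ne {N : ℕ} (x : Edge N → ℝ) {i j : Fin N} (h : i ≠ j) :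
    symmMatrix x i j = x (edge h) := by
  rw [symmMatrix, adj_of_ne _ _ h, Pi.one_apply, mul_one]

/-- Expanding the square gives the quadratic form of MᵀM, and |v_j v_k| ≤ 1 removes v. The diagonal
contributes at most Nκ; for the off-diagonal part, Cauchy-Schwarz over the N² pairs turns the bound
κ² on the sum of squares into Nκ. -/
theorem sq_sum_mulVec_le {N : ℕ} {M : Fin N → Fin N → ℝ} {κ : ℝ} (hκ : 0 ≤ κ)
    (hd : ∑ i, ∑ j, M i j ^ 2 ≤ N * κ)
    (ho : ∑ j, ∑ k, (if j = k then 0 else ∑ i, M i j * M i k) ^ 2 ≤ κ ^ 2)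
    {v : Fin N → ℝ} (hv : ∀ j, |v j| ≤ 1) :
    ∑ i, (∑ j, M i j * v j) ^ 2 ≤ N * (2 * κ) := by
  set C : Fin N × Fin N → ℝ := fun q => if q.1 = q.2 then 0 else ∑ i, M i q.1 * M i q.2 with hC
  have hexp : ∑ i, (∑ j, M i j * v j) ^ 2 = ∑ j, ∑ k, v j * v k * ∑ i, M i j * M i k := by
    simp only [sq, Finset.sum_mul_sum]
    rw [Finset.sum_comm]
    refine Finset.sum_congr rfl fun j _ => ?_
    rw [Finset.sum_comm]
    refine Finset.sum_congr rfl fun k _ => ?_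
    rw [Finset.mul_sum]
    exact Finset.sum_congr rfl fun i _ => by ring
  have hvv : ∀ j k, |v j * v k| ≤ 1 := fun j k => by
    rw [abs_mul]
    exact mul_le_one₀ (hv j) (abs_nonneg _) (hv k)
  have hterm : ∀ j k, v j * v k * ∑ i, M i j * M i k ≤
      (if j = k then ∑ i, M i j ^ 2 else 0) + |C (j, k)| := by
    intro j k
    refine (le_abs_self _).trans ?_
    rw [abs_mul]
    refine (mul_le_of_le_one_left (abs_nonneg _) (hvv j k)).trans ?_
    rcases eq_or_ne j k with rfl | hjk
    · have : |∑ i, M i j * M i j| = ∑ i, M i j ^ 2 := by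
        rw [abs_of_nonneg (Finset.sum_nonneg fun i _ => mul_self_nonneg _)]
        simp only [sq]
      simp [hC, this]
    · simp [hC, hjk]
  have hCsum : ∑ q, |C q| ≤ N * κ := by
    refine abs_le_of_sq_le_sq' ?_ (by positivity) |>.2
    refine sq_sum_le_card_mul_sum_sq.trans ?_
    have : ∑ q, |C q| ^ 2 ≤ κ ^ 2 := by
      rw [Fintype.sum_prod_type]
      simpa only [sq_abs, hC] using ho
    calc _ ≤ ((Finset.univ : Finset (Fin N × Fin N)).card : ℝ) * κ ^ 2 := by gcongr
      _ = _ := by simp; ring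
  rw [hexp]
  calc _ ≤ ∑ j, ∑ k, ((if j = k then ∑ i, M i j ^ 2 else 0) + |C (j, k)|) :=
        Finset.sum_le_sum fun j _ => Finset.sum_le_sum fun k _ => hterm j k
    _ = ∑ i, ∑ j, M i j ^ 2 + ∑ q, |C q| := by
        simp only [Finset.sum_add_distrib, Finset.sum_ite_eq, Finset.mem_univ, if_true]
        rw [Finset.sum_comm, Fintype.sum_prod_type]
    _ ≤ _ := by linarith

theorem sum_abs_mulVec_le {N : ℕ} {M : Fin N → Fin N → ℝ} {κ : ℝ} (hκ : 0 ≤ κ)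
    (hd : ∑ i, ∑ j, M i j ^ 2 ≤ N * κ)
    (ho : ∑ j, ∑ k, (if j = k then 0 else ∑ i, M i j * M i k) ^ 2 ≤ κ ^ 2)
    {v : Fin N → ℝ} (hv : ∀ j, |v j| ≤ 1) :
    ∑ i, |∑ j, M i j * v j| ≤ N * √(2 * κ) := by
  refine abs_le_of_sq_le_sq' ?_ (by positivity) |>.2
  refine sq_sum_le_card_mul_sum_sq.trans ?_
  simp only [sq_abs]
  rw [mul_pow, Real.sq_sqrt (by positivity), Finset.card_univ, Fintype.card_fin, sq, mul_assoc]
  gcongr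
  exact sq_sum_mulVec_le hκ hd ho hv

/-- The environments deviate little from the average if the centred adjacency matrix is small. -/
theorem deviation_le {N S : ℕ} (hN : 2 ≤ N) {d : ℝ} {a : Fin N → Fin N → ℝ} {κ : ℝ} (hκ : 0 ≤ κ)
    {M : Fin N → Fin N → ℝ} (hM0 : ∀ i, M i i = 0) (ha0 : ∀ i, a i i = 0)
    (hM : ∀ i j, i ≠ j → M i j = d⁻¹ * a i j - ((N : ℝ) - 1)⁻¹)
    (hd : ∑ i, ∑ j, M i j ^ 2 ≤ N * κ)
    (ho : ∑ j, ∑ k, (if j = k then 0 else ∑ i, M i j * M i k) ^ 2 ≤ κ ^ 2)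
    {v : Fin N → Fin S → ℝ} (hv : ∀ i, v i ∈ stdSimplex ℝ (Fin S)) :
    deviation d a v ≤ S * (√(2 * κ) + 2 / ((N : ℝ) - 1)) := by
  have hN1 : (1 : ℝ) ≤ (N : ℝ) - 1 := by
    have : (2 : ℝ) ≤ N := by exact_mod_cast hN
    linarith
  have hN1' : (0 : ℝ) < (N : ℝ) - 1 := by linarith
  have hN0 : (0 : ℝ) < N := by linarith
  -- The centring term averages over the N - 1 other vertices rather than over all N; the second
  -- summand is exactly this discrepancy.
  have hcoord : ∀ i s, environment d a v i s - average v s =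
      ∑ j, M i j * v j s + ((N : ℝ)⁻¹ * ∑ j, v j s - v i s) / ((N : ℝ) - 1) := by
    intro i s
    rw [environment_apply, average_apply]
    have h1 : ∀ j, M i j * v j s = d⁻¹ * (a i j * v j s) - ((N : ℝ) - 1)⁻¹ * v j s +
        (if j = i then ((N : ℝ) - 1)⁻¹ * v i s else 0) := by
      intro j
      rcases eq_or_ne i j with rfl | hij
      · simp [hM0, ha0]
      · rw [hM i j hij, if_neg hij.symm]; ring
    simp only [h1, Finset.sum_add_distrib, Finset.sum_sub_distrib, ← Finset.mul_sum,
      Finset.sum_ite_eq', Finset.mem_univ, if_true]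
    field_simp
    ring
  have hsmall : ∀ i s, |((N : ℝ)⁻¹ * ∑ j, v j s - v i s) / ((N : ℝ) - 1)| ≤ 2 / ((N : ℝ) - 1) := by
    intro i s
    rw [abs_div, abs_of_pos hN1']
    gcongr
    have h1 := abs_le_one_of_mem_stdSimplex (average_mem_stdSimplex (by omega) hv) s
    rw [average_apply] at h1
    have h2 := abs_le_one_of_mem_stdSimplex (hv i) s
    have := abs_sub ((N : ℝ)⁻¹ * ∑ j, v j s) (v i s)
    linarith
  rw [deviation, inv_mul_le_iff₀ hN0]
  calc ∑ i, ‖environment d a v i - average v‖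
      ≤ ∑ i, ∑ s, (|∑ j, M i j * v j s| + 2 / ((N : ℝ) - 1)) := by
        refine Finset.sum_le_sum fun i _ => ?_
        refine (pi_norm_le_iff_of_nonneg (by positivity)).2 fun s => ?_
        rw [Pi.sub_apply, Real.norm_eq_abs, hcoord]
        calc _ ≤ |∑ j, M i j * v j s| + 2 / ((N : ℝ) - 1) :=
              (abs_add_le _ _).trans (add_le_add le_rfl (hsmall i s))
          _ ≤ _ := Finset.single_le_sum
              (f := fun s => |∑ j, M i j * v j s| + 2 / ((N : ℝ) - 1))
              (fun _ _ => by positivity) (Finset.mem_univ s)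
    _ = ∑ s, (∑ i, |∑ j, M i j * v j s| + N * (2 / ((N : ℝ) - 1))) := by
        rw [Finset.sum_comm]
        simp [Finset.sum_add_distrib]
    _ ≤ ∑ s : Fin S, (N * √(2 * κ) + N * (2 / ((N : ℝ) - 1))) := by
        gcongr with s
        exact sum_abs_mulVec_le hκ hd ho fun j => abs_le_one_of_mem_stdSimplex (hv j) s
    _ = _ := by simp; ring

-- Moments of the Gram matrix of a random symmetric matrix

section Moments

variable {Ω : Type*} [MeasurableSpace Ω] {P : Measure Ω} {N : ℕ}

/-- Families of random variables over disjoint sets of edges are independent. -/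
def EdgeIndep (P : Measure Ω) (X : Edge N → Ω → ℝ) : Prop :=
  ∀ A B : Finset (Edge N), Disjoint A B →
    IndepFun (fun ω (e : A) => X e ω) (fun ω (e : B) => X e ω) P

theorem EdgeIndep.comp {X : Edge N → Ω → ℝ} (h : EdgeIndep P X) {g : ℝ → ℝ} (hg : Measurable g) :
    EdgeIndep P (fun e ω => g (X e ω)) := fun A B hAB =>
  (h A B hAB).comp (φ := fun x e => g (x e)) (ψ := fun x e => g (x e)) (by fun_prop) (by fun_prop)

theorem EdgeIndep.indepFun {X : Edge N → Ω → ℝ} (h : EdgeIndep P X) {e f : Edge N} (hef : e ≠ f) :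
    IndepFun (X e) (X f) P :=
  (h {e} {f} (by simpa using hef)).comp
    (φ := fun x : ({e} : Finset (Edge N)) → ℝ => x ⟨e, by simp⟩)
    (ψ := fun x : ({f} : Finset (Edge N)) → ℝ => x ⟨f, by simp⟩) (by fun_prop) (by fun_prop)

theorem EdgeIndep.indepFun_mul {X : Edge N → Ω → ℝ} (h : EdgeIndep P X) {e e' f f' : Edge N}
    (h1 : e ≠ f) (h2 : e ≠ f') (h3 : e' ≠ f) (h4 : e' ≠ f') :
    IndepFun (fun ω => X e ω * X e' ω) (fun ω => X f ω * X f' ω) P :=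
  (h {e, e'} {f, f'} (by
      rw [Finset.disjoint_left]
      intro a ha hb
      simp only [Finset.mem_insert, Finset.mem_singleton] at ha hb
      rcases ha with rfl | rfl <;> rcases hb with rfl | rfl <;> contradiction)).comp
    (φ := fun x : ({e, e'} : Finset (Edge N)) → ℝ => x ⟨e, by simp⟩ * x ⟨e', by simp⟩)
    (ψ := fun x : ({f, f'} : Finset (Edge N)) → ℝ => x ⟨f, by simp⟩ * x ⟨f', by simp⟩) (by fun_prop) (by fun_prop)

/-- The weights and indicators over `A` together, and those over `B`, are disjoint blocks of one
independent family, and the products are functions of their own block. -/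
theorem IsWeightedErdosRenyi.edgeIndep {ν : Measure ℝ} {p : ℝ} {w b : Edge N → Ω → ℝ}
    (hG : IsWeightedErdosRenyi P ν p w b) : EdgeIndep P (fun e ω => w e ω * b e ω) := by
  intro A B hAB
  have hmeas : ∀ q, Measurable ((Sum.elim w b : Edge N ⊕ Edge N → Ω → ℝ) q) := by
    rintro (e | e)
    · exact hG.measurable_w e
    · exact hG.measurable_b e
  have hdisj : Disjoint (A.disjSum A) (B.disjSum B) := by
    rw [Finset.disjoint_left] at hAB ⊢
    rintro (e | e) h h'
    · exact hAB (by simpa using h) (by simpa using h')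
    · exact hAB (by simpa using h) (by simpa using h')
  exact (hG.indep.indepFun_finset _ _ hdisj hmeas).comp
    (φ := fun (x : ↥(A.disjSum A) → ℝ) (e : A) =>
      x ⟨Sum.inl e, by simp⟩ * x ⟨Sum.inr e, by simp⟩)
    (ψ := fun (x : ↥(B.disjSum B) → ℝ) (e : B) =>
      x ⟨Sum.inl e, by simp⟩ * x ⟨Sum.inr e, by simp⟩)
    (by fun_prop) (by fun_prop)

variable [IsProbabilityMeasure P] {X : Edge N → Ω → ℝ} {V : ℝ}

theorem integral_sum_sq_symmMatrix_le (hX : ∀ e, MemLp (X e) 2 P)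
    (hV0 : 0 ≤ V) (hV : ∀ e, ∫ ω, X e ω ^ 2 ∂P ≤ V) :
    Integrable (fun ω => ∑ i, ∑ j, symmMatrix (fun e => X e ω) i j ^ 2) P ∧
    ∫ ω, ∑ i, ∑ j, symmMatrix (fun e => X e ω) i j ^ 2 ∂P ≤ N ^ 2 * V := by
  have h_int : ∀ i j, Integrable (fun ω => symmMatrix (fun e => X e ω) i j ^ 2) P ∧
      ∫ ω, symmMatrix (fun e => X e ω) i j ^ 2 ∂P ≤ V := by
    intro i j
    rcases eq_or_ne i j with rfl | hij
    · simp [adj_self, hV0]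
    · simp only [symmMatrix_of_ne _ hij]
      exact ⟨(hX _).integrable_sq, hV _⟩
  refine ⟨integrable_finsetSum _ fun i _ => integrable_finsetSum _ fun j _ => (h_int i j).1, ?_⟩
  rw [integral_finsetSum _ fun i _ => integrable_finsetSum _ fun j _ => (h_int i j).1]
  calc _ ≤ ∑ i : Fin N, ∑ j : Fin N, V := by
        refine Finset.sum_le_sum fun i _ => ?_
        rw [integral_finsetSum _ fun j _ => (h_int i j).1]
        exact Finset.sum_le_sum fun j _ => (h_int i j).2
    _ = _ := by simp; ring

/-- For j ≠ k the summands X_ij X_ik are centred, and for different i they use disjoint pairs of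
edges. Hence they are pairwise independent, and the second moment of the sum is the sum of at most N
variances, each at most V². For j = k the summands are squares, no longer centred; this is why the
diagonal is treated apart. -/
theorem integral_sq_sum_mul_symmMatrix_le (hind : EdgeIndep P X) (hXm : ∀ e, Measurable (X e))
    (hX : ∀ e, MemLp (X e) 2 P) (h0 : ∀ e, ∫ ω, X e ω ∂P = 0)
    (hV0 : 0 ≤ V) (hV : ∀ e, ∫ ω, X e ω ^ 2 ∂P ≤ V) {j k : Fin N} (hjk : j ≠ k) :
    Integrable (fun ω => (∑ i, symmMatrix (fun e => X e ω) i j *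
      symmMatrix (fun e => X e ω) i k) ^ 2) P ∧
    ∫ ω, (∑ i, symmMatrix (fun e => X e ω) i j * symmMatrix (fun e => X e ω) i k) ^ 2 ∂P ≤
      N * V ^ 2 := by
  set Y : Fin N → Ω → ℝ := fun i ω =>
    symmMatrix (fun e => X e ω) i j * symmMatrix (fun e => X e ω) i k with hY
  have hYne : ∀ i (hij : i ≠ j) (hik : i ≠ k), Y i = fun ω => X (edge hij) ω * X (edge hik) ω :=
    fun i hij hik => by
      ext ω
      simp only [hY, symmMatrix_of_ne _ hij, symmMatrix_of_ne _ hik]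
  have hY0 : ∀ i, i = j ∨ i = k → Y i = fun _ => 0 := by
    rintro i (rfl | rfl) <;> ext ω <;> simp [hY, adj_self]
  have hne : ∀ {i} (hij : i ≠ j) (hik : i ≠ k), edge hij ≠ edge hik := fun hij hik h => by
    rcases (edge_eq_iff hij hik).1 h with h | h
    · exact hjk h.2
    · exact hik h.1
  have hYprop : ∀ i, MemLp (Y i) 2 P ∧ ∫ ω, Y i ω ∂P = 0 ∧ ∫ ω, Y i ω ^ 2 ∂P ≤ V ^ 2 := by
    intro i
    by_cases hi : i = j ∨ i = k
    · rw [hY0 i hi]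
      simp [sq_nonneg]
    · push Not at hi
      have hI := hind.indepFun (hne hi.1 hi.2)
      have hI2 : IndepFun (fun ω => X (edge hi.1) ω ^ 2) (fun ω => X (edge hi.2) ω ^ 2) P :=
        hI.comp (φ := fun x => x ^ 2) (ψ := fun x => x ^ 2) (by fun_prop) (by fun_prop)
      rw [hYne i hi.1 hi.2]
      have hsq : (fun ω => (X (edge hi.1) ω * X (edge hi.2) ω) ^ 2) =
          fun ω => X (edge hi.1) ω ^ 2 * X (edge hi.2) ω ^ 2 := by
        ext ω; ring
      refine ⟨?_, ?_, ?_⟩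
      · rw [memLp_two_iff_integrable_sq ((hXm _).fun_mul (hXm _)).aestronglyMeasurable, hsq]
        exact hI2.integrable_mul (hX _).integrable_sq (hX _).integrable_sq
      · rw [hI.integral_fun_mul_eq_mul_integral (hXm _).aestronglyMeasurable
          (hXm _).aestronglyMeasurable, h0, zero_mul]
      · rw [hsq, hI2.integral_fun_mul_eq_mul_integral ((hXm _).pow_const 2).aestronglyMeasurable
          ((hXm _).pow_const 2).aestronglyMeasurable, sq]
        exact mul_le_mul (hV _) (hV _) (integral_nonneg fun _ => sq_nonneg _) hV0
  have hpair : (↑(Finset.univ : Finset (Fin N)) : Set (Fin N)).Pairwise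
      fun i i' => IndepFun (Y i) (Y i') P := by
    intro i _ i' _ hii
    by_cases hi : i = j ∨ i = k
    · rw [hY0 i hi]
      exact indepFun_const_left 0 _
    by_cases hi' : i' = j ∨ i' = k
    · rw [hY0 i' hi']
      exact indepFun_const_right _ 0
    push Not at hi hi'
    rw [hYne i hi.1 hi.2, hYne i' hi'.1 hi'.2]
    -- The edges ij, ik differ from i'j, i'k because i ≠ i' and neither of them is j or k.
    refine hind.indepFun_mul ?_ ?_ ?_ ?_ <;> rw [Ne, edge_eq_iff] <;> tauto
  have hsum : ∫ ω, ∑ i, Y i ω ∂P = 0 := by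
    rw [integral_finsetSum _ fun i _ => (hYprop i).1.integrable one_le_two]
    exact Finset.sum_eq_zero fun i _ => (hYprop i).2.1
  have hmem : MemLp (∑ i, Y i) 2 P := memLp_finsetSum' _ fun i _ => (hYprop i).1
  have hfun : (∑ i, Y i) = fun ω => ∑ i, Y i ω := by ext ω; simp
  refine ⟨by simpa [hfun] using hmem.integrable_sq, ?_⟩
  have hvar := IndepFun.variance_sum (fun i _ => (hYprop i).1) hpair
  rw [hfun, variance_of_integral_eq_zero (by simpa [hfun] using hmem.aemeasurable) hsum] at hvar
  rw [hvar]
  calc _ ≤ ∑ i : Fin N, V ^ 2 := by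
        refine Finset.sum_le_sum fun i _ => ?_
        refine (variance_le_expectation_sq (hYprop i).1.aestronglyMeasurable).trans ?_
        simpa using (hYprop i).2.2
    _ = _ := by simp

theorem integral_sum_sq_offDiag_le (hind : EdgeIndep P X) (hXm : ∀ e, Measurable (X e))
    (hX : ∀ e, MemLp (X e) 2 P) (h0 : ∀ e, ∫ ω, X e ω ∂P = 0)
    (hV0 : 0 ≤ V) (hV : ∀ e, ∫ ω, X e ω ^ 2 ∂P ≤ V) :
    Integrable (fun ω => ∑ j, ∑ k, (if j = k then 0 else
      ∑ i, symmMatrix (fun e => X e ω) i j * symmMatrix (fun e => X e ω) i k) ^ 2) P ∧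
    ∫ ω, ∑ j, ∑ k, (if j = k then 0 else
      ∑ i, symmMatrix (fun e => X e ω) i j * symmMatrix (fun e => X e ω) i k) ^ 2 ∂P ≤
      N ^ 3 * V ^ 2 := by
  have h_int : ∀ j k, Integrable (fun ω => (if j = k then 0 else
      ∑ i, symmMatrix (fun e => X e ω) i j * symmMatrix (fun e => X e ω) i k) ^ 2) P ∧
      ∫ ω, (if j = k then 0 else
      ∑ i, symmMatrix (fun e => X e ω) i j * symmMatrix (fun e => X e ω) i k) ^ 2 ∂P ≤
      N * V ^ 2 := by
    intro j k
    rcases eq_or_ne j k with rfl | hjk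
    · simp only [if_true]
      simp
      positivity
    · simp only [if_neg hjk]
      exact integral_sq_sum_mul_symmMatrix_le hind hXm hX h0 hV0 hV hjk
  refine ⟨integrable_finsetSum _ fun i _ => integrable_finsetSum _ fun j _ => (h_int i j).1, ?_⟩
  rw [integral_finsetSum _ fun i _ => integrable_finsetSum _ fun j _ => (h_int i j).1]
  calc _ ≤ ∑ i : Fin N, ∑ j : Fin N, N * V ^ 2 := by
        refine Finset.sum_le_sum fun i _ => ?_
        rw [integral_finsetSum _ fun j _ => (h_int i j).1]
        exact Finset.sum_le_sum fun j _ => (h_int i j).2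
    _ = _ := by simp; ring

end Moments

-- Typical graphs: near homogeneity and bounded degrees

/-- The centred and normalized adjacency matrix. -/
noncomputable def centered {N : ℕ} (d : ℝ) (a : Fin N → Fin N → ℝ) (i j : Fin N) : ℝ :=
  if i = j then 0 else d⁻¹ * a i j - ((N : ℝ) - 1)⁻¹

/-- The adjacency matrices whose centred version is small, as measured by `κ`. -/
def nearlyHomogeneous (N : ℕ) (d κ : ℝ) : Set (Fin N → Fin N → ℝ) :=
  {a | ∑ i, ∑ j, centered d a i j ^ 2 ≤ N * κ ∧
    ∑ j, ∑ k, (if j = k then 0 else ∑ i, centered d a i j * centered d a i k) ^ 2 ≤ κ ^ 2}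

theorem measurable_centered {N : ℕ} (d : ℝ) (i j : Fin N) :
    Measurable fun a : Fin N → Fin N → ℝ => centered d a i j := by
  unfold centered
  split_ifs <;> fun_prop

theorem measurableSet_nearlyHomogeneous (N : ℕ) (d κ : ℝ) :
    MeasurableSet (nearlyHomogeneous N d κ) := by
  have h := measurable_centered (N := N) d
  have h1 : Measurable fun a : Fin N → Fin N → ℝ => ∑ i, ∑ j, centered d a i j ^ 2 := by fun_prop
  have h2 : Measurable fun a : Fin N → Fin N → ℝ =>
      ∑ j, ∑ k, (if j = k then 0 else ∑ i, centered d a i j * centered d a i k) ^ 2 := by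
    refine Finset.measurable_fun_sum _ fun j _ => Finset.measurable_fun_sum _ fun k _ => ?_
    split_ifs <;> fun_prop
  exact (measurableSet_le h1 measurable_const).inter (measurableSet_le h2 measurable_const)

theorem deviation_le_of_mem_nearlyHomogeneous {N S : ℕ} (hN : 2 ≤ N) {d κ : ℝ} (hκ : 0 ≤ κ)
    {a : Fin N → Fin N → ℝ} (ha0 : ∀ i, a i i = 0) (ha : a ∈ nearlyHomogeneous N d κ)
    {v : Fin N → Fin S → ℝ} (hv : ∀ i, v i ∈ stdSimplex ℝ (Fin S)) :
    deviation d a v ≤ S * (√(2 * κ) + 2 / ((N : ℝ) - 1)) :=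
  deviation_le hN hκ (M := centered d a) (by simp [centered]) ha0
    (fun i j h => by simp [centered, h]) ha.1 ha.2 hv

section Graph

variable {Ω : Type*} [MeasurableSpace Ω] {P : Measure Ω} {N : ℕ}
  {ν : Measure ℝ} {p : ℝ} {w b : Edge N → Ω → ℝ}

theorem measurable_adj (hG : IsWeightedErdosRenyi P ν p w b) :
    Measurable fun ω => adj (fun e => w e ω) (fun e => b e ω) := by
  refine measurable_pi_lambda _ fun i => measurable_pi_lambda _ fun j => ?_
  have h1 := hG.measurable_w
  have h2 := hG.measurable_b
  unfold adj
  split_ifs <;> fun_prop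

theorem IsWeightedErdosRenyi.ae_mul_nonneg (hG : IsWeightedErdosRenyi P ν p w b)
    (hν : ∀ᵐ x ∂ν, 0 ≤ x) : ∀ᵐ ω ∂P, ∀ e, 0 ≤ w e ω * b e ω := by
  refine ae_all_iff.2 fun e => ?_
  have h1 : ∀ᵐ ω ∂P, 0 ≤ w e ω := by
    rw [← hG.law_w e] at hν
    exact ae_of_ae_map (hG.measurable_w e).aemeasurable hν
  filter_upwards [h1, hG.b_zero_or_one e] with ω h1 h2
  rcases h2 with h | h <;> simp [h, h1]

theorem IsWeightedErdosRenyi.integral_comp_w (hG : IsWeightedErdosRenyi P ν p w b) (e : Edge N)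
    {g : ℝ → ℝ} (hg : Measurable g) : ∫ ω, g (w e ω) ∂P = ∫ x, g x ∂ν := by
  rw [← hG.law_w e, integral_map (hG.measurable_w e).aemeasurable hg.aestronglyMeasurable]

theorem IsWeightedErdosRenyi.b_ae_eq (hG : IsWeightedErdosRenyi P ν p w b) (e : Edge N) :
    b e =ᵐ[P] Set.indicator {ω | b e ω = 1} 1 := by
  filter_upwards [hG.b_zero_or_one e] with ω h
  rcases h with h | h <;> simp [Set.indicator, h]

theorem IsWeightedErdosRenyi.integral_b (hG : IsWeightedErdosRenyi P ν p w b) (e : Edge N) :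
    ∫ ω, b e ω ∂P = p := by
  have hm : MeasurableSet {ω | b e ω = 1} := hG.measurable_b e (measurableSet_singleton 1)
  rw [integral_congr_ae (hG.b_ae_eq e), integral_indicator_one hm, measureReal_def, hG.prob_b,
    ENNReal.toReal_ofReal hG.p_mem.1]

theorem IsWeightedErdosRenyi.indepFun_w_b (hG : IsWeightedErdosRenyi P ν p w b) (e : Edge N) :
    IndepFun (w e) (b e) P :=
  hG.indep.indepFun (i := Sum.inl e) (j := Sum.inr e) (by simp)

theorem IsWeightedErdosRenyi.integral_mul (hG : IsWeightedErdosRenyi P ν p w b) (e : Edge N) :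
    ∫ ω, w e ω * b e ω ∂P = (∫ x, x ∂ν) * p := by
  rw [(hG.indepFun_w_b e).integral_fun_mul_eq_mul_integral
    (hG.measurable_w e).aestronglyMeasurable (hG.measurable_b e).aestronglyMeasurable,
    hG.integral_b, hG.integral_comp_w e measurable_id']

theorem IsWeightedErdosRenyi.integral_sq_mul (hG : IsWeightedErdosRenyi P ν p w b) (e : Edge N) :
    ∫ ω, (w e ω * b e ω) ^ 2 ∂P = (∫ x, x ^ 2 ∂ν) * p := by
  have h : (fun ω => (w e ω * b e ω) ^ 2) =ᵐ[P] fun ω => w e ω ^ 2 * b e ω := by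
    filter_upwards [hG.b_zero_or_one e] with ω h
    rcases h with h | h <;> simp [h]
  have hI : IndepFun (fun ω => w e ω ^ 2) (b e) P :=
    (hG.indepFun_w_b e).comp (φ := fun x => x ^ 2) (ψ := id) (by fun_prop) measurable_id
  rw [integral_congr_ae h, hI.integral_fun_mul_eq_mul_integral
    ((hG.measurable_w e).pow_const 2).aestronglyMeasurable
    (hG.measurable_b e).aestronglyMeasurable, hG.integral_b,
    hG.integral_comp_w e (g := fun x => x ^ 2) (by fun_prop)]

theorem IsWeightedErdosRenyi.memLp_mul (hG : IsWeightedErdosRenyi P ν p w b)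
    (hν : MemLp id 2 ν) (e : Edge N) : MemLp (fun ω => w e ω * b e ω) 2 P := by
  have h1 : MemLp (w e) 2 P := by
    rw [← hG.law_w e] at hν
    exact (memLp_map_measure_iff hν.aestronglyMeasurable (hG.measurable_w e).aemeasurable).1 hν
  refine h1.mono ((hG.measurable_w e).fun_mul (hG.measurable_b e)).aestronglyMeasurable ?_
  filter_upwards [hG.b_zero_or_one e] with ω h
  rcases h with h | h <;> simp [h]

variable [IsProbabilityMeasure P]

/-- The centred adjacency matrix is small with high probability. -/
theorem IsWeightedErdosRenyi.prob_not_nearlyHomogeneous (hG : IsWeightedErdosRenyi P ν p w b)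
    (hν : MemLp id 2 ν) (hμ : 0 < ∫ x, x ∂ν) (hN : 2 ≤ N) (hp : 0 < p) {κ : ℝ} (hκ : 0 < κ) :
    P {ω | adj (fun e => w e ω) (fun e => b e ω) ∉
        nearlyHomogeneous N (avgDegree N p (∫ x, x ∂ν)) κ} ≤
      ENNReal.ofReal (4 * (∫ x, x ^ 2 ∂ν) / (∫ x, x ∂ν) ^ 2 / (N * p) / κ) +
      ENNReal.ofReal ((4 * (∫ x, x ^ 2 ∂ν) / (∫ x, x ∂ν) ^ 2) ^ 2 / (N * p ^ 2) / κ ^ 2) := by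
  set μ := ∫ x, x ∂ν with hμdef
  set m2 := ∫ x, x ^ 2 ∂ν with hm2
  set d := avgDegree N p μ with hd
  have hm20 : 0 ≤ m2 := integral_nonneg fun x => sq_nonneg x
  have hN2 : (2 : ℝ) ≤ N := by exact_mod_cast hN
  have hN1 : (0 : ℝ) < N - 1 := by linarith
  have hN0 : (0 : ℝ) < N := by linarith
  have hd0 : 0 < d := by rw [hd, avgDegree]; positivity
  set X : Edge N → Ω → ℝ := fun e ω => d⁻¹ * (w e ω * b e ω) - ((N : ℝ) - 1)⁻¹ with hX
  have hind : EdgeIndep P X :=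
    hG.edgeIndep.comp (g := fun x => d⁻¹ * x - ((N : ℝ) - 1)⁻¹) (by fun_prop)
  have hXm : ∀ e, Measurable (X e) := fun e => by
    have h1 := hG.measurable_w e
    have h2 := hG.measurable_b e
    fun_prop
  have hXL : ∀ e, MemLp (X e) 2 P := fun e =>
    ((hG.memLp_mul hν e).const_mul _).sub (memLp_const _)
  have hwb := fun e => (hG.memLp_mul hν e).integrable one_le_two
  have hX0 : ∀ e, ∫ ω, X e ω ∂P = 0 := fun e => by
    rw [integral_sub ((hwb e).const_mul _) (integrable_const _), integral_const_mul,
      hG.integral_mul, integral_const, probReal_univ, hd, avgDegree]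
    simp only [smul_eq_mul, one_mul]
    field_simp
    ring
  -- The uncentred second moment of d⁻¹ w b. Since b² = b it carries a single factor p, so V is of
  -- order 1/(N²p).
  set V : ℝ := m2 * p / d ^ 2 with hV
  have hV0 : 0 ≤ V := by positivity
  have hXV : ∀ e, ∫ ω, X e ω ^ 2 ∂P ≤ V := fun e => by
    have hX2 : ∀ ω, X e ω ^ 2 = d⁻¹ ^ 2 * (w e ω * b e ω) ^ 2 -
        2 * ((N : ℝ) - 1)⁻¹ * (d⁻¹ * (w e ω * b e ω)) + (((N : ℝ) - 1)⁻¹) ^ 2 := fun ω => by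
      simp only [hX]; ring
    simp only [hX2]
    have hi1 : Integrable (fun ω => d⁻¹ ^ 2 * (w e ω * b e ω) ^ 2) P :=
      (hG.memLp_mul hν e).integrable_sq.const_mul _
    have hi2 : Integrable (fun ω => 2 * ((N : ℝ) - 1)⁻¹ * (d⁻¹ * (w e ω * b e ω))) P :=
      ((hwb e).const_mul _).const_mul _
    have hi3 : Integrable (fun ω => d⁻¹ ^ 2 * (w e ω * b e ω) ^ 2 -
        2 * ((N : ℝ) - 1)⁻¹ * (d⁻¹ * (w e ω * b e ω))) P := hi1.sub hi2
    rw [integral_add hi3 (integrable_const _), integral_sub hi1 hi2,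
      integral_const_mul, integral_const_mul, integral_const_mul, hG.integral_mul,
      hG.integral_sq_mul, integral_const, probReal_univ]
    have h1 : d⁻¹ * (μ * p) = ((N : ℝ) - 1)⁻¹ := by
      rw [hd, avgDegree]; field_simp
    rw [← hμdef, ← hm2, h1]
    have h2 : d⁻¹ ^ 2 * (m2 * p) = V := by rw [hV]; field_simp
    rw [h2]
    simp only [one_smul]
    nlinarith [sq_nonneg ((N : ℝ) - 1)⁻¹]
  have hcent : ∀ ω, centered d (adj (fun e => w e ω) (fun e => b e ω)) =
      symmMatrix (fun e => X e ω) := fun ω => by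
    ext i j
    rcases eq_or_ne i j with rfl | hij
    · rw [symmMatrix, adj_self]; simp [centered]
    · rw [symmMatrix_of_ne _ hij, centered, if_neg hij, adj_of_ne _ _ hij]
  obtain ⟨hi1, hb1⟩ := integral_sum_sq_symmMatrix_le hXL hV0 hXV
  obtain ⟨hi2, hb2⟩ := integral_sum_sq_offDiag_le hind hXm hXL hX0 hV0 hXV
  -- The 4 comes from N ≤ 2(N - 1), valid for N ≥ 2.
  have hNV : N * V ≤ 4 * m2 / μ ^ 2 / (N * p) := by
    rw [hV, hd, avgDegree, div_div, ← mul_div_assoc, div_le_div_iff₀ (by positivity)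
      (by positivity)]
    have h4 : (N : ℝ) ^ 2 ≤ 4 * ((N : ℝ) - 1) ^ 2 := by nlinarith
    have h5 : 0 ≤ m2 * p ^ 2 * μ ^ 2 := by positivity
    calc N * (m2 * p) * (μ ^ 2 * (N * p)) = (N : ℝ) ^ 2 * (m2 * p ^ 2 * μ ^ 2) := by ring
      _ ≤ 4 * ((N : ℝ) - 1) ^ 2 * (m2 * p ^ 2 * μ ^ 2) := by gcongr
      _ = _ := by ring
  have markov : ∀ {f : Ω → ℝ}, (∀ ω, 0 ≤ f ω) → Integrable f P → ∀ {c : ℝ}, 0 < c →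
      P {ω | c ≤ f ω} ≤ ENNReal.ofReal ((∫ ω, f ω ∂P) / c) := by
    intro f hf hfi c hc
    rw [← ENNReal.ofReal_toReal (measure_ne_top P {ω | c ≤ f ω})]
    refine ENNReal.ofReal_le_ofReal ?_
    rw [le_div_iff₀ hc, mul_comm]
    exact mul_meas_ge_le_integral_of_nonneg (Eventually.of_forall hf) hfi c
  refine (measure_mono (t := {ω | N * κ ≤ ∑ i, ∑ j, symmMatrix (fun e => X e ω) i j ^ 2} ∪
    {ω | κ ^ 2 ≤ ∑ j, ∑ k, (if j = k then 0 else
      ∑ i, symmMatrix (fun e => X e ω) i j * symmMatrix (fun e => X e ω) i k) ^ 2}) ?_).trans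
    ((measure_union_le _ _).trans (add_le_add ?_ ?_))
  · intro ω hω
    by_contra hcon
    simp only [Set.mem_union, Set.mem_ofPred_eq, not_or, not_le] at hcon
    apply hω
    simp only [nearlyHomogeneous, Set.mem_ofPred_eq, hcent]
    exact ⟨hcon.1.le, hcon.2.le⟩
  · refine (markov (fun ω => by positivity) hi1 (by positivity)).trans
      (ENNReal.ofReal_le_ofReal ?_)
    rw [← div_div]
    refine div_le_div_of_nonneg_right ?_ hκ.le
    rw [div_le_iff₀ hN0]
    nlinarith
  · refine (markov (fun ω => by positivity) hi2 (by positivity)).trans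
      (ENNReal.ofReal_le_ofReal ?_)
    gcongr
    refine hb2.trans ?_
    -- This quantity is of order 1/(Np²), the source of the requirement Np² → ∞.
    calc (N : ℝ) ^ 3 * V ^ 2 = N * (N * V) ^ 2 := by ring
      _ ≤ N * (4 * m2 / μ ^ 2 / (N * p)) ^ 2 := by gcongr
      _ = _ := by field_simp

/-- With all links present and exponential moments, the degrees are comparable to the average. -/
theorem IsWeightedErdosRenyi.prob_large_degree (hG : IsWeightedErdosRenyi P ν 1 w b)
    {θ : ℝ} (hθ : 0 < θ) (h_int : Integrable (fun x => Real.exp (θ * x)) ν) (c : ℝ) :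
    P {ω | ∃ i, c < ∑ j, adj (fun e => w e ω) (fun e => b e ω) i j} ≤
      ENNReal.ofReal (N * (Real.exp (-θ * c) * (max 1 (∫ x, Real.exp (θ * x) ∂ν)) ^ N)) := by
  -- With m ≥ 1 the power of m can be raised from the number of edges at a vertex to N.
  set m := max 1 (∫ x, Real.exp (θ * x) ∂ν) with hm
  have hb : ∀ᵐ ω ∂P, ∀ e, b e ω = 1 := by
    refine ae_all_iff.2 fun e => ?_
    have hm : MeasurableSet {ω | b e ω = 1} := hG.measurable_b e (measurableSet_singleton 1)
    exact (mem_ae_iff_prob_eq_one hm).2 (by simpa using hG.prob_b e)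
  have hw : iIndepFun w P := hG.indep.precomp (g := Sum.inl) Sum.inl_injective
  have hwi : ∀ e, Integrable (fun ω => Real.exp (θ * w e ω)) P := fun e => by
    rw [← hG.law_w e] at h_int
    exact (integrable_map_measure h_int.aestronglyMeasurable
      (hG.measurable_w e).aemeasurable).1 h_int
  have hmgf : ∀ e, mgf (w e) P θ ≤ m := fun e => by
    rw [mgf, hG.integral_comp_w e (g := fun x => Real.exp (θ * x)) (by fun_prop)]
    exact le_max_right _ _
  -- The edges at vertex i. As all links are present almost surely, the degree of i is a sum of
  -- independent weights over `A i`, to which Chernoff's bound applies.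
  set A : Fin N → Finset (Edge N) := fun i =>
    (Finset.univ.filter fun j => i ≠ j).attach.image
      fun j => edge (Finset.mem_filter.1 j.2).2 with hA
  have hsum : ∀ ω, (∀ e, b e ω = 1) → ∀ i,
      ∑ j, adj (fun e => w e ω) (fun e => b e ω) i j = (∑ e ∈ A i, w e) ω := by
    intro ω hω i
    rw [Finset.sum_apply, hA, Finset.sum_image]
    · rw [← Finset.sum_filter_add_sum_filter_not Finset.univ (fun j => i ≠ j)]
      have h0 : ∑ j ∈ Finset.univ.filter (fun j => ¬ i ≠ j),
          adj (fun e => w e ω) (fun e => b e ω) i j = 0 := by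
        refine Finset.sum_eq_zero fun j hj => ?_
        have : i = j := by simpa using hj
        rw [this, adj_self]
      rw [h0, add_zero, ← Finset.sum_attach]
      refine Finset.sum_congr rfl fun j _ => ?_
      rw [adj_of_ne _ _ (Finset.mem_filter.1 j.2).2, hω, mul_one]
    · intro j _ k _ hjk
      have hj := (Finset.mem_filter.1 j.2).2
      rcases (edge_eq_iff _ _).1 hjk with h | h
      · exact Subtype.ext h.2
      · exact absurd h.2.symm hj
  have hcard : ∀ i, (A i).card ≤ N := fun i => by
    refine Finset.card_image_le.trans ?_
    rw [Finset.card_attach]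
    exact (Finset.card_filter_le _ _).trans (by simp)
  have hone : ∀ i, P {ω | c ≤ (∑ e ∈ A i, w e) ω} ≤
      ENNReal.ofReal (Real.exp (-θ * c) * m ^ N) := by
    intro i
    rw [← ENNReal.ofReal_toReal (measure_ne_top P {ω | c ≤ (∑ e ∈ A i, w e) ω})]
    refine ENNReal.ofReal_le_ofReal ?_
    refine (measure_ge_le_exp_mul_mgf c hθ.le
      (hw.integrable_exp_mul_sum hG.measurable_w fun e _ => hwi e)).trans ?_
    rw [hw.mgf_sum hG.measurable_w]
    gcongr
    calc ∏ e ∈ A i, mgf (w e) P θ ≤ ∏ e ∈ A i, m :=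
          Finset.prod_le_prod (fun _ _ => mgf_nonneg) fun e _ => hmgf e
      _ = m ^ (A i).card := by simp
      _ ≤ m ^ N := pow_le_pow_right₀ (le_max_left _ _) (hcard i)
  calc _ ≤ P (⋃ i, {ω | c ≤ (∑ e ∈ A i, w e) ω}) := by
        refine measure_mono_ae ?_
        filter_upwards [hb] with ω hω hex
        obtain ⟨i, hi⟩ := hex
        rw [hsum ω hω i] at hi
        exact Set.mem_iUnion.2 ⟨i, hi.le⟩
    _ ≤ ∑ i : Fin N, ENNReal.ofReal (Real.exp (-θ * c) * m ^ N) :=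
        (measure_iUnion_fintype_le _ _).trans (Finset.sum_le_sum fun i _ => hone i)
    _ = _ := by
        rw [Finset.sum_const, Finset.card_univ, Fintype.card_fin, nsmul_eq_mul,
          ENNReal.ofReal_mul (p := (N : ℝ)) (by positivity), ENNReal.ofReal_natCast]

end Graph

-- A maximal inequality for martingale differences

section Martingale

variable {Ω : Type*} {m0 : MeasurableSpace Ω} {μ : Measure Ω} [IsProbabilityMeasure μ]
  {ℱ : Filtration ℕ m0} {D : ℕ → Ω → ℝ}

theorem condExp_sum_mul_eq_zero (hmeas : ∀ k, StronglyMeasurable[ℱ (k + 1)] (D k))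
    (hL2 : ∀ k, MemLp (D k) 2 μ) (hcond : ∀ k, μ[D k | ℱ k] =ᵐ[μ] 0) (k : ℕ) :
    μ[(fun ω => ∑ j ∈ Finset.range k, D j ω) * D k | ℱ k] =ᵐ[μ] 0 := by
  have hM : StronglyMeasurable[ℱ k] fun ω => ∑ j ∈ Finset.range k, D j ω :=
    Finset.stronglyMeasurable_fun_sum _ fun j hj =>
      (hmeas j).mono (ℱ.mono (Finset.mem_range.1 hj))
  have hML : MemLp (fun ω => ∑ j ∈ Finset.range k, D j ω) 2 μ :=
    memLp_finsetSum _ fun j _ => hL2 j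
  have h := condExp_mul_of_stronglyMeasurable_left hM (hML.integrable_mul (hL2 k))
    ((hL2 k).integrable one_le_two)
  filter_upwards [h, hcond k] with ω h1 h2
  rw [h1, Pi.mul_apply, h2]
  simp

theorem integral_sq_sum_le (hmeas : ∀ k, StronglyMeasurable[ℱ (k + 1)] (D k))
    (hL2 : ∀ k, MemLp (D k) 2 μ) (hcond : ∀ k, μ[D k | ℱ k] =ᵐ[μ] 0) {v : ℝ}
    (hv : ∀ k, ∫ ω, D k ω ^ 2 ∂μ ≤ v) (n : ℕ) :
    ∫ ω, (∑ j ∈ Finset.range n, D j ω) ^ 2 ∂μ ≤ n * v := by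
  induction n with
  | zero => simp
  | succ k ih =>
    have hML : MemLp (fun ω => ∑ j ∈ Finset.range k, D j ω) 2 μ :=
      memLp_finsetSum _ fun j _ => hL2 j
    have hcross : ∫ ω, ((fun ω => ∑ j ∈ Finset.range k, D j ω) * D k) ω ∂μ = 0 := by
      rw [← integral_condExp (ℱ.le k), integral_congr_ae (condExp_sum_mul_eq_zero hmeas hL2 hcond k)]
      simp
    have hexp : ∀ ω, (∑ j ∈ Finset.range (k + 1), D j ω) ^ 2 =
        (∑ j ∈ Finset.range k, D j ω) ^ 2 +
          2 * ((fun ω => ∑ j ∈ Finset.range k, D j ω) * D k) ω + D k ω ^ 2 := fun ω => by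
      rw [Finset.sum_range_succ, Pi.mul_apply]; ring
    simp only [hexp]
    have hi1 := hML.integrable_sq
    have hi2 : Integrable (fun ω => 2 * ((fun ω => ∑ j ∈ Finset.range k, D j ω) * D k) ω) μ :=
      (hML.integrable_mul (hL2 k)).const_mul 2
    have hi3 : Integrable (fun ω => (∑ j ∈ Finset.range k, D j ω) ^ 2 +
        2 * ((fun ω => ∑ j ∈ Finset.range k, D j ω) * D k) ω) μ := hi1.add hi2
    rw [integral_add hi3 (hL2 k).integrable_sq, integral_add hi1 hi2, integral_const_mul, hcross]
    push_cast
    linarith [hv k]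

/-- Kolmogorov's maximal inequality for square-integrable martingale differences. -/
theorem prob_exists_sum_ge_le (hmeas : ∀ k, StronglyMeasurable[ℱ (k + 1)] (D k))
    (hL2 : ∀ k, MemLp (D k) 2 μ) (hcond : ∀ k, μ[D k | ℱ k] =ᵐ[μ] 0) {v : ℝ}
    (hv : ∀ k, ∫ ω, D k ω ^ 2 ∂μ ≤ v) (n : ℕ) {δ : ℝ} (hδ : 0 < δ) :
    μ {ω | ∃ k ≤ n, δ ≤ |∑ j ∈ Finset.range k, D j ω|} ≤ ENNReal.ofReal (n * v / δ ^ 2) := by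
  set f : ℕ → Ω → ℝ := fun k ω => (∑ j ∈ Finset.range k, D j ω) ^ 2 with hf
  have hML : ∀ k, MemLp (fun ω => ∑ j ∈ Finset.range k, D j ω) 2 μ :=
    fun k => memLp_finsetSum _ fun j _ => hL2 j
  -- Doob's maximal inequality is applied to the square of the martingale; its increment is a cross
  -- term of conditional mean zero plus a square.
  have hsub : Submartingale f ℱ μ := by
    refine submartingale_of_condExp_sub_nonneg_nat ?_ (fun k => (hML k).integrable_sq) fun k => ?_
    · intro k
      exact (Finset.stronglyMeasurable_fun_sum _ fun j hj =>
        (hmeas j).mono (ℱ.mono (Finset.mem_range.1 hj))).pow 2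
    · have hexp : f (k + 1) - f k = (2 : ℝ) • ((fun ω => ∑ j ∈ Finset.range k, D j ω) * D k) +
          fun ω => D k ω ^ 2 := by
        ext ω
        simp only [hf, Pi.sub_apply, Pi.add_apply, Pi.smul_apply, Pi.mul_apply, smul_eq_mul,
          Finset.sum_range_succ]
        ring
      have hi2 := (hML k).integrable_mul (hL2 k)
      rw [hexp]
      filter_upwards [condExp_add (hi2.smul (2 : ℝ)) (hL2 k).integrable_sq (ℱ k),
        condExp_smul (2 : ℝ) ((fun ω => ∑ j ∈ Finset.range k, D j ω) * D k) (ℱ k) (μ := μ),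
        condExp_sum_mul_eq_zero hmeas hL2 hcond k,
        condExp_nonneg (μ := μ) (m := ℱ k) (f := fun ω => D k ω ^ 2)
          (Eventually.of_forall fun ω => sq_nonneg _)] with ω h1 h2 h3 h4
      rw [h1, Pi.add_apply, h2, Pi.smul_apply, h3]
      simpa using h4
  have hmax := maximal_ineq (ε := (δ ^ 2).toNNReal) hsub (fun k ω => sq_nonneg _) n
  set A := {ω | ((δ ^ 2).toNNReal : ℝ) ≤
    (Finset.range (n + 1)).sup' Finset.nonempty_range_add_one fun k => f k ω} with hA
  have hsubset : {ω | ∃ k ≤ n, δ ≤ |∑ j ∈ Finset.range k, D j ω|} ⊆ A := by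
    rintro ω ⟨k, hk, hδk⟩
    change ((δ ^ 2).toNNReal : ℝ) ≤ _
    rw [Real.coe_toNNReal _ (by positivity)]
    refine le_trans ?_ (Finset.le_sup' (fun k => f k ω) (Finset.mem_range.2 (Nat.lt_succ_of_le hk)))
    simp only [hf]
    rw [← sq_abs (∑ j ∈ Finset.range k, D j ω)]
    gcongr
  have h_int : ∫ ω in A, f n ω ∂μ ≤ n * v :=
    (setIntegral_le_integral (hML n).integrable_sq
      (Eventually.of_forall fun ω => sq_nonneg _)).trans (integral_sq_sum_le hmeas hL2 hcond hv n)
  refine (measure_mono hsubset).trans ?_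
  rw [ENNReal.ofReal_div_of_pos (by positivity), ENNReal.le_div_iff_mul_le
    (Or.inl (by simpa using hδ.ne')) (Or.inl ENNReal.ofReal_ne_top), mul_comm]
  exact hmax.trans (ENNReal.ofReal_le_ofReal h_int)

end Martingale

-- Small-time expansion of the semigroup

section Exponential

attribute [local instance] Matrix.linftyOpNormedRing Matrix.linftyOpNormedAlgebra
  Matrix.linftyOpNormedAddCommGroup

/-- First-order expansion of the semigroup of a matrix with bounded entries. -/
theorem exists_exp_expansion {n : Type*} [Fintype n] [DecidableEq n] (B : ℝ) {τ : ℝ} (hτ : 0 < τ) :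
    ∃ h₀ > 0, ∀ h, 0 < h → h < h₀ → ∀ G : Matrix n n ℝ, (∀ x y, |G x y| ≤ B) →
      ∀ g : n → ℝ, (∀ x, |g x| ≤ 1) → ∀ x,
        |∑ y, NormedSpace.exp (h • G) x y * g y - g x - h * ∑ y, G x y * g y| ≤ τ * h := by
  set B' : ℝ := Fintype.card n * |B| with hB'
  have hB0 : 0 ≤ B' := by positivity
  have hrow : ∀ (A : Matrix n n ℝ) x, ∑ y, |A x y| ≤ ‖A‖ := fun A x => by
    rw [Matrix.linfty_opNorm_def]
    have := Finset.le_sup (f := fun i => ∑ j, ‖A i j‖₊) (Finset.mem_univ x)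
    have h2 := NNReal.coe_le_coe.2 this
    simpa using h2
  have hnorm : ∀ G : Matrix n n ℝ, (∀ x y, |G x y| ≤ B) → ‖G‖ ≤ B' := fun G hG => by
    rw [Matrix.linfty_opNorm_def]
    have : (Finset.univ.sup fun i => ∑ j, ‖G i j‖₊) ≤ ⟨B', hB0⟩ := by
      refine Finset.sup_le fun x _ => NNReal.coe_le_coe.1 ?_
      push_cast
      calc ∑ y, ‖G x y‖ ≤ ∑ _y : n, |B| :=
            Finset.sum_le_sum fun y _ => (hG x y).trans (le_abs_self B)
        _ = B' := by simp [hB']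
    exact NNReal.coe_le_coe.2 this
  -- Differentiability of exp at the zero matrix makes the remainder uniform over all generators
  -- with entries bounded by B. The norm is the maximal absolute row sum, which is what testing
  -- against |g| ≤ 1 requires.
  have hd := (hasFDerivAt_exp_zero (𝕂 := ℝ) (𝔸 := Matrix n n ℝ))
  rw [hasFDerivAt_iff_isLittleO_nhds_zero] at hd
  have hc : 0 < τ / (B' + 1) := by positivity
  obtain ⟨ε, hε, hball⟩ := Metric.eventually_nhds_iff.1 (hd.bound hc)
  refine ⟨ε / (B' + 1), by positivity, fun h hh hh0 G hG g hg x => ?_⟩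
  have hGn := hnorm G hG
  have hhG : ‖h • G‖ ≤ h * B' := by
    rw [norm_smul, Real.norm_of_nonneg hh.le]
    gcongr
  have hlt : dist (h • G) 0 < ε := by
    rw [dist_zero_right]
    refine hhG.trans_lt ?_
    rw [lt_div_iff₀ (by positivity)] at hh0
    nlinarith
  have hrem : ‖NormedSpace.exp (h • G) - 1 - h • G‖ ≤ τ * h := by
    have h1 := hball hlt
    simp only [zero_add, NormedSpace.exp_zero] at h1
    calc _ ≤ τ / (B' + 1) * ‖h • G‖ := h1
      _ ≤ τ / (B' + 1) * (h * (B' + 1)) := by gcongr; nlinarith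
      _ = _ := by field_simp
  have heq : ∑ y, NormedSpace.exp (h • G) x y * g y - g x - h * ∑ y, G x y * g y =
      ∑ y, (NormedSpace.exp (h • G) - 1 - h • G) x y * g y := by
    simp only [Matrix.sub_apply, Matrix.smul_apply, sub_mul, Finset.sum_sub_distrib, smul_eq_mul,
      Matrix.one_apply, Finset.mul_sum, ite_mul, one_mul, zero_mul, Finset.sum_ite_eq,
      Finset.mem_univ, if_true, mul_assoc]
  rw [heq]
  refine (Finset.abs_sum_le_sum_abs _ _).trans (le_trans ?_ ((hrow _ x).trans hrem))
  refine Finset.sum_le_sum fun y _ => ?_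
  rw [abs_mul]
  exact mul_le_of_le_one_right (abs_nonneg _) (hg y)

end Exponential

-- Drift and quadratic variation of the densities

section Generator

variable {N S : ℕ} {Q : (Fin S → ℝ) → Matrix (Fin S) (Fin S) ℝ} {d : ℝ} {a : Fin N → Fin N → ℝ}

/-- A configuration agreeing with η off i is determined by its value k at i. The choice k = η i
gives η itself for every i, in agreement with the sum over all vertices on the diagonal of
`generator`. -/
theorem sum_generator_mul (g : Config N S → ℝ) (η : Config N S) :
    ∑ η', generator Q d a η η' * g η' =
      ∑ i, ∑ k, Q (environment d a (indicators η) i) k (η i) * g (Function.update η i k) := by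
  simp only [generator, Finset.sum_mul, ite_mul, zero_mul]
  rw [Finset.sum_comm]
  refine Finset.sum_congr rfl fun i _ => ?_
  rw [← Finset.sum_filter]
  refine Finset.sum_bij' (fun η' _ => η' i) (fun k _ => Function.update η i k)
    (by simp) ?_ ?_ (by simp) ?_
  · intro k _
    simp only [Finset.mem_filter, Finset.mem_univ, true_and]
    intro j hj
    rw [Function.update_of_ne hj]
  · intro η' hη'
    simp only [Finset.mem_filter, Finset.mem_univ, true_and] at hη'
    ext j
    by_cases hj : j = i
    · subst hj; simp
    · rw [Function.update_of_ne hj, hη' j hj]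
  · intro η' hη'
    simp only [Finset.mem_filter, Finset.mem_univ, true_and] at hη'
    congr 2
    ext j
    by_cases hj : j = i
    · subst hj; simp
    · rw [Function.update_of_ne hj, hη' j hj]

theorem average_indicators_update_sub (η : Config N S) (i : Fin N) (k s : Fin S) :
    average (indicators (Function.update η i k)) s - average (indicators η) s =
      (N : ℝ)⁻¹ * ((if k = s then 1 else 0) - if η i = s then 1 else 0) := by
  rw [average_apply, average_apply, ← mul_sub, ← Finset.sum_sub_distrib,
    Finset.sum_eq_single i]
  · simp [indicators]
  · intro j _ hj
    simp [indicators, Function.update_of_ne hj]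
  · simp

/-- The drift of the density of state `s`. -/
theorem sum_generator_mul_average_sub (hQ : IsRateFunction Q) (η : Config N S) (s : Fin S) :
    ∑ η', generator Q d a η η' * (average (indicators η') s - average (indicators η) s) =
      average (fun i => Q (environment d a (indicators η) i) *ᵥ indicators η i) s := by
  rw [sum_generator_mul (fun η' => average (indicators η') s - average (indicators η) s),
    average_apply (fun i => Q (environment d a (indicators η) i) *ᵥ indicators η i), Finset.mul_sum]
  refine Finset.sum_congr rfl fun i _ => ?_
  simp only [average_indicators_update_sub]
  set A := Q (environment d a (indicators η) i) with hA
  have h1 : ∑ k, A k (η i) * ((N : ℝ)⁻¹ * ((if k = s then 1 else 0) - if η i = s then 1 else 0)) =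
      (N : ℝ)⁻¹ * (∑ k, A k (η i) * (if k = s then 1 else 0)) -
      (N : ℝ)⁻¹ * (if η i = s then 1 else 0) * ∑ k, A k (η i) := by
    rw [Finset.mul_sum, Finset.mul_sum, ← Finset.sum_sub_distrib]
    exact Finset.sum_congr rfl fun k _ => by ring
  rw [h1, hA, hQ.sum_col]
  simp [Matrix.mulVec, dotProduct, indicators]

/-- The rate of growth of the quadratic variation of the density of state `s`. -/
theorem sum_generator_mul_sq_average_sub_le (η : Config N S) (s : Fin S) :
    ∑ η', generator Q d a η η' * (average (indicators η') s - average (indicators η) s) ^ 2 ≤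
      (N : ℝ)⁻¹ * ((N : ℝ)⁻¹ *
        ∑ i, ∑ k, |Q (environment d a (indicators η) i) k (η i)|) := by
  rw [sum_generator_mul (fun η' => (average (indicators η') s - average (indicators η) s) ^ 2),
    ← mul_assoc, Finset.mul_sum]
  refine Finset.sum_le_sum fun i _ => ?_
  rw [Finset.mul_sum]
  refine Finset.sum_le_sum fun k _ => ?_
  -- Each jump changes a density by at most 1/N, so N vertices together contribute 1/N times the
  -- mean rate.
  rw [average_indicators_update_sub, mul_pow, mul_comm]
  have h1 : ((if k = s then (1 : ℝ) else 0) - if η i = s then 1 else 0) ^ 2 ≤ 1 := by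
    split_ifs <;> norm_num
  have h2 : Q (environment d a (indicators η) i) k (η i) ≤
      |Q (environment d a (indicators η) i) k (η i)| := le_abs_self _
  calc _ ≤ (N : ℝ)⁻¹ ^ 2 * ((if k = s then (1 : ℝ) else 0) - if η i = s then 1 else 0) ^ 2 *
        |Q (environment d a (indicators η) i) k (η i)| := by gcongr
    _ ≤ (N : ℝ)⁻¹ ^ 2 * 1 * |Q (environment d a (indicators η) i) k (η i)| := by gcongr
    _ = _ := by ring

theorem abs_generator_le {B : ℝ} (hB0 : 0 ≤ B)
    (hB : ∀ (η : Config N S) i k s, |Q (environment d a (indicators η) i) k s| ≤ B)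
    (η η' : Config N S) : |generator Q d a η η'| ≤ N * B := by
  unfold generator
  refine (Finset.abs_sum_le_sum_abs _ _).trans ?_
  calc _ ≤ ∑ _i : Fin N, B := by
        refine Finset.sum_le_sum fun i _ => ?_
        split_ifs
        · exact hB _ _ _ _
        · simpa using hB0
    _ = _ := by simp

end Generator

-- Discrete Grönwall inequality

/-- Both sequences are perturbed Euler schemes for F, and x carries an additional noise D.
Subtracting the accumulated noise leaves y, whose recursion no longer contains D; the noise then
matters only through the largest of its partial sums, not through the sum of its norms. -/
theorem norm_sub_le_of_discrete_recursion {E : Type*} [NormedAddCommGroup E] [NormedSpace ℝ E]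
    {x u D : ℕ → E} {F : E → E} {h K ε δ₀ δ₁ : ℝ} {n : ℕ} (hh : 0 ≤ h) (hK : 0 ≤ K) (hε : 0 ≤ ε)
    (hx : ∀ k < n, ‖x (k + 1) - x k - D k - h • F (x k)‖ ≤ h * ε)
    (hu : ∀ k < n, ‖u (k + 1) - u k - h • F (u k)‖ ≤ h * ε)
    (hF : ∀ k < n, ‖F (x k) - F (u k)‖ ≤ K * ‖x k - u k‖)
    (hD : ∀ k ≤ n, ‖∑ j ∈ Finset.range k, D j‖ ≤ δ₁) (h0 : ‖x 0 - u 0‖ ≤ δ₀)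
    {k : ℕ} (hk : k ≤ n) :
    ‖x k - u k‖ ≤ (δ₀ + δ₁ + n * h * (2 * ε)) * Real.exp (K * (n * h)) := by
  have hδ0 : 0 ≤ δ₀ := (norm_nonneg _).trans h0
  have hδ1 : 0 ≤ δ₁ := (norm_nonneg _).trans (hD 0 (Nat.zero_le _))
  set y : ℕ → E := fun k => x k - u k - ∑ j ∈ Finset.range k, D j with hy
  have hxy : ∀ k ≤ n, ‖x k - u k‖ ≤ ‖y k‖ + δ₁ := fun k hk => by
    have : x k - u k = y k + ∑ j ∈ Finset.range k, D j := by simp [hy]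
    rw [this]
    exact (norm_add_le _ _).trans (add_le_add le_rfl (hD k hk))
  -- Adding δ₁ to ‖y k‖ absorbs the noise in the Lipschitz term: this sum grows by a factor 1 + hK
  -- plus 2hε per step.
  have key : ∀ k ≤ n, ‖y k‖ + δ₁ ≤ (δ₀ + δ₁ + k * h * (2 * ε)) * (1 + h * K) ^ k := by
    intro k
    induction k with
    | zero => intro _; simpa [hy] using h0
    | succ k ih =>
      intro hk
      have hkn : k < n := hk
      have ih := ih hkn.le
      have hstep : y (k + 1) = y k + (x (k + 1) - x k - D k - h • F (x k)) -
          (u (k + 1) - u k - h • F (u k)) + h • (F (x k) - F (u k)) := by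
        simp only [hy, Finset.sum_range_succ, smul_sub]
        abel
      have h1 : ‖y (k + 1)‖ ≤ ‖y k‖ + h * ε + h * ε + h * (K * (‖y k‖ + δ₁)) := by
        rw [hstep]
        refine (norm_add_le _ _).trans (add_le_add ((norm_sub_le _ _).trans
          (add_le_add ((norm_add_le _ _).trans (add_le_add le_rfl (hx k hkn))) (hu k hkn))) ?_)
        rw [norm_smul, Real.norm_of_nonneg hh]
        gcongr
        exact (hF k hkn).trans (by gcongr; exact hxy k hkn.le)
      have hone : 1 ≤ (1 + h * K) ^ (k + 1) := one_le_pow₀ (by nlinarith [mul_nonneg hh hK])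
      calc ‖y (k + 1)‖ + δ₁ ≤ (1 + h * K) * (‖y k‖ + δ₁) + h * (2 * ε) * 1 := by linarith
        _ ≤ (1 + h * K) * ((δ₀ + δ₁ + k * h * (2 * ε)) * (1 + h * K) ^ k) +
            h * (2 * ε) * (1 + h * K) ^ (k + 1) := by gcongr
        _ = _ := by push_cast; ring
  refine (hxy k hk).trans ((key k hk).trans ?_)
  have h2 : (1 + h * K) ^ k ≤ Real.exp (K * (n * h)) := by
    calc (1 + h * K) ^ k ≤ Real.exp (h * K) ^ k := by
          gcongr
          linarith [Real.add_one_le_exp (h * K)]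
      _ = Real.exp (k * (h * K)) := by rw [← Real.exp_nat_mul]
      _ ≤ _ := by
          refine Real.exp_le_exp.2 ?_
          have : (k : ℝ) ≤ n := by exact_mod_cast hk
          calc (k : ℝ) * (h * K) ≤ n * (h * K) := by gcongr
            _ = _ := by ring
  have hkn : (k : ℝ) ≤ n := by exact_mod_cast hk
  gcongr

-- The chain on a time grid

section LocalDensity

variable {Ω : Type*} {N S : ℕ} {Q : (Fin S → ℝ) → Matrix (Fin S) (Fin S) ℝ} {d : ℝ}
  {a : Ω → Fin N → Fin N → ℝ} {ξ : ℝ → Ω → Config N S}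

theorem history_mono (a : Ω → Fin N → Fin N → ℝ) (ξ : ℝ → Ω → Config N S) {r t : ℝ} (h : r ≤ t) :
    history a ξ r ≤ history a ξ t :=
  sup_le_sup_left (iSup₂_le fun q hq =>
    le_iSup₂_of_le (f := fun q (_ : q ∈ Set.Icc (0 : ℝ) t) =>
      MeasurableSpace.comap (ξ q) inferInstance) q ⟨hq.1, hq.2.trans h⟩ le_rfl) _

theorem measurable_history {q r : ℝ} (hq : 0 ≤ q) (hqr : q ≤ r) :
    Measurable[history a ξ r] (ξ q) := by
  refine Measurable.mono (comap_measurable (ξ q)) ?_ le_rfl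
  exact le_sup_of_le_right (le_iSup₂_of_le (f := fun q (_ : q ∈ Set.Icc (0 : ℝ) r) =>
    MeasurableSpace.comap (ξ q) inferInstance) q ⟨hq, hqr⟩ le_rfl)

theorem measurableSet_history_preimage {𝒜 : Set (Fin N → Fin N → ℝ)} (h𝒜 : MeasurableSet 𝒜)
    (r : ℝ) : MeasurableSet[history a ξ r] (a ⁻¹' 𝒜) :=
  (le_sup_left : _ ≤ history a ξ r) _ ⟨𝒜, h𝒜, rfl⟩

theorem stronglyMeasurable_history_indicator {𝒜 : Set (Fin N → Fin N → ℝ)}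
    (h𝒜 : MeasurableSet 𝒜) (g : Config N S → Config N S → ℝ) {q r t : ℝ} (hq : 0 ≤ q)
    (hqr : q ≤ r) (ht : 0 ≤ t) (htr : t ≤ r) :
    StronglyMeasurable[history a ξ r]
      ((a ⁻¹' 𝒜).indicator fun ω => g (ξ q ω) (ξ t ω)) := by
  refine StronglyMeasurable.indicator ?_ (measurableSet_history_preimage h𝒜 r)
  refine @Measurable.stronglyMeasurable _ _ (_) _ _ _ _ _ _ ?_
  have h1 : Measurable fun c : Config N S × Config N S => g c.1 c.2 := Measurable.of_discrete
  exact h1.comp ((measurable_history hq hqr).prodMk (measurable_history ht htr))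

variable [mΩ : MeasurableSpace Ω] {P : Measure Ω}

theorem history_le (ha : Measurable a) (hξ : ∀ t, 0 ≤ t → Measurable (ξ t)) (r : ℝ) :
    history a ξ r ≤ mΩ :=
  sup_le ha.comap_le (iSup₂_le fun q hq => (hξ q hq.1).comap_le)

variable [IsProbabilityMeasure P]

/-- Decompose according to the value η' of ξ at time t. The remaining factor, including the
indicator of the graph event, is known at time r and can be pulled out; the Markov property
evaluates the rest. -/
theorem IsLocalDensityProcess.condExp_indicator (ha : Measurable a)
    (hξ : IsLocalDensityProcess P Q d a ξ) {𝒜 : Set (Fin N → Fin N → ℝ)} (h𝒜 : MeasurableSet 𝒜)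
    {g : Config N S → Config N S → ℝ} (hg : ∀ η η', |g η η'| ≤ 1) {r t : ℝ} (hr : 0 ≤ r)
    (hrt : r ≤ t) :
    P[(a ⁻¹' 𝒜).indicator (fun ω => g (ξ r ω) (ξ t ω)) | history a ξ r] =ᵐ[P]
      (a ⁻¹' 𝒜).indicator fun ω =>
        ∑ η', NormedSpace.exp ((t - r) • generator Q d (a ω)) (ξ r ω) η' * g (ξ r ω) η' := by
  have hle := history_le (a := a) ha hξ.measurable r
  set φ : Config N S → Ω → ℝ := fun η' => (a ⁻¹' 𝒜).indicator fun ω => g (ξ r ω) η' with hφ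
  set χ : Config N S → Ω → ℝ := fun η' => Set.indicator {ω | ξ t ω = η'} (fun _ => (1 : ℝ)) with hχ
  have hφm : ∀ η', StronglyMeasurable[history a ξ r] (φ η') := fun η' =>
    stronglyMeasurable_history_indicator h𝒜 (fun η _ => g η η') hr le_rfl hr le_rfl
  have hφb : ∀ η' ω, ‖φ η' ω‖ ≤ 1 := fun η' ω => by
    simp only [hφ, Set.indicator]
    split_ifs
    · exact hg _ _
    · simp
  have hχm : ∀ η', MeasurableSet {ω | ξ t ω = η'} := fun η' =>
    hξ.measurable t (hr.trans hrt) (measurableSet_singleton η')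
  have hχi : ∀ η', Integrable (χ η') P := fun η' =>
    (integrable_const (1 : ℝ)).indicator (hχm η')
  have hmuli : ∀ η', Integrable (φ η' * χ η') P := fun η' =>
    (hχi η').bdd_mul ((hφm η').mono hle).aestronglyMeasurable
      (Eventually.of_forall (hφb η'))
  have hsum : (a ⁻¹' 𝒜).indicator (fun ω => g (ξ r ω) (ξ t ω)) = ∑ η', φ η' * χ η' := by
    ext ω
    simp only [Finset.sum_apply, Pi.mul_apply]
    rw [Finset.sum_eq_single (ξ t ω)]
    · by_cases hω : ω ∈ a ⁻¹' 𝒜 <;> simp [hφ, hχ, hω]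
    · intro η' _ hne
      simp [hχ, hne.symm]
    · simp
  rw [hsum]
  have h1 := condExp_finsetSum (μ := P) (s := Finset.univ) (f := fun η' => φ η' * χ η')
    (fun η' _ => hmuli η') (history a ξ r)
  have h2 : ∀ᵐ ω ∂P, ∀ η', P[φ η' * χ η' | history a ξ r] ω =
      φ η' ω * NormedSpace.exp ((t - r) • generator Q d (a ω)) (ξ r ω) η' := by
    refine ae_all_iff.2 fun η' => ?_
    filter_upwards [condExp_mul_of_stronglyMeasurable_left (hφm η') (hmuli η') (hχi η'),
      hξ.markov r t hr hrt η'] with ω h3 h4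
    rw [h3, Pi.mul_apply, h4]
  filter_upwards [h1, h2] with ω h1 h2
  rw [h1, Finset.sum_apply]
  simp only [h2]
  by_cases hω : ω ∈ a ⁻¹' 𝒜
  · simp only [hφ, Set.indicator_of_mem hω, mul_comm]
  · simp [hφ, Set.indicator_of_notMem hω]

/-- The graph and the process up to the grid points `k * h` form a filtration. -/
def gridFiltration (ha : Measurable a) (hξ : ∀ t, 0 ≤ t → Measurable (ξ t)) {h : ℝ} (hh : 0 ≤ h) :
    Filtration ℕ mΩ where
  seq k := history a ξ (k * h)
  mono' k l hkl := history_mono a ξ (by gcongr)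
  le' k := history_le ha hξ _

theorem abs_average_indicators_sub_le (hN : N ≠ 0) (η η' : Config N S) (s : Fin S) :
    |average (indicators η') s - average (indicators η) s| ≤ 1 := by
  have h1 := average_mem_stdSimplex hN (indicators_mem_stdSimplex η)
  have h2 := average_mem_stdSimplex hN (indicators_mem_stdSimplex η')
  have h3 := abs_le_one_of_mem_stdSimplex h1 s
  have h4 := abs_le_one_of_mem_stdSimplex h2 s
  rw [abs_le] at *
  constructor <;> linarith [h1.1 s, h2.1 s]

/-- The probability that the densities leave the neighbourhood of the mean-field solution at one
of the grid points. -/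
theorem IsLocalDensityProcess.prob_grid_le (hQ : IsRateFunction Q) (hN : N ≠ 0) (ha : Measurable a)
    (hξ : IsLocalDensityProcess P Q d a ξ) {𝒜 : Set (Fin N → Fin N → ℝ)} (h𝒜 : MeasurableSet 𝒜)
    {u : ℝ → Fin S → ℝ} {n : ℕ} {h τ ε₁ C K δ ε : ℝ} (hh : 0 < h) (hτ : 0 ≤ τ) (hε₁ : 0 ≤ ε₁)
    (hC : 0 ≤ C) (hK : 0 ≤ K) (hδ : 0 < δ)
    (hexp : ∀ a ∈ 𝒜, ∀ g : Config N S → ℝ, (∀ η, |g η| ≤ 1) → ∀ η,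
      |∑ η', NormedSpace.exp (h • generator Q d a) η η' * g η' - g η -
        h * ∑ η', generator Q d a η η' * g η'| ≤ τ * h)
    (hdrift : ∀ a ∈ 𝒜, ∀ η : Config N S,
      ‖average (fun i => Q (environment d a (indicators η) i) *ᵥ indicators η i) -
        Q (average (indicators η)) *ᵥ average (indicators η)‖ ≤ ε₁)
    (hrate : ∀ a ∈ 𝒜, ∀ η : Config N S,
      (N : ℝ)⁻¹ * ∑ i, ∑ k, |Q (environment d a (indicators η) i) k (η i)| ≤ C)
    (hF : ∀ v ∈ stdSimplex ℝ (Fin S), ∀ v' ∈ stdSimplex ℝ (Fin S),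
      ‖Q v *ᵥ v - Q v' *ᵥ v'‖ ≤ K * ‖v - v'‖)
    (hus : ∀ t, 0 ≤ t → u t ∈ stdSimplex ℝ (Fin S))
    (hu : ∀ k < n, ‖u ((k + 1 : ℕ) * h) - u (k * h) - h • (Q (u (k * h)) *ᵥ u (k * h))‖ ≤ h * τ)
    (hε : (2 * δ + n * h * (2 * (ε₁ + τ))) * Real.exp (K * (n * h)) ≤ ε) :
    P {ω | a ω ∈ 𝒜 ∧ ‖average (indicators (ξ 0 ω)) - u 0‖ ≤ δ ∧
        ∃ k ≤ n, ε < ‖average (indicators (ξ (k * h) ω)) - u (k * h)‖} ≤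
      S * ENNReal.ofReal (n * (h * (C / N + τ)) / δ ^ 2) := by
  set ℱ := gridFiltration ha hξ.measurable hh.le with hℱ
  have ht0 : ∀ k : ℕ, 0 ≤ (k : ℝ) * h := fun k => by positivity
  have htk : ∀ k : ℕ, (k : ℝ) * h ≤ (k + 1 : ℕ) * h := fun k => by push_cast; nlinarith
  have htd : ∀ k : ℕ, ((k + 1 : ℕ) : ℝ) * h - k * h = h := fun k => by push_cast; ring
  set g : Fin S → Config N S → Config N S → ℝ := fun s η η' =>
    average (indicators η') s - average (indicators η) s with hg
  have hg1 : ∀ s η η', |g s η η'| ≤ 1 := fun s η η' => abs_average_indicators_sub_le hN η η' s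
  have hg2 : ∀ s η η', |g s η η' ^ 2| ≤ 1 := fun s η η' => by
    rw [abs_pow]
    exact pow_le_one₀ (abs_nonneg _) (hg1 s η η')
  -- Increments of the density of s, set to zero off the graphs in `𝒜`, where the bounds need not
  -- hold. The graph belongs to every history, so adaptedness is preserved.
  set Y : Fin S → ℕ → Ω → ℝ := fun s k =>
    (a ⁻¹' 𝒜).indicator fun ω => g s (ξ (k * h) ω) (ξ ((k + 1 : ℕ) * h) ω) with hY
  have hYm : ∀ s k, StronglyMeasurable[ℱ (k + 1)] (Y s k) := fun s k =>
    stronglyMeasurable_history_indicator h𝒜 (g s) (ht0 k) (htk k) (ht0 (k + 1)) le_rfl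
  have hYL : ∀ s k, MemLp (Y s k) 2 P := fun s k => by
    refine MemLp.of_bound ((hYm s k).mono (ℱ.le _)).aestronglyMeasurable 1
      (Eventually.of_forall fun ω => ?_)
    simp only [hY, Set.indicator]
    split_ifs
    · exact hg1 _ _ _
    · simp
  have hYi := fun s k => (hYL s k).integrable one_le_two
  -- The martingale differences of the Doob decomposition.
  set D : Fin S → ℕ → Ω → ℝ := fun s k => Y s k - P[Y s k | ℱ k] with hD
  have hDm : ∀ s k, StronglyMeasurable[ℱ (k + 1)] (D s k) := fun s k =>
    (hYm s k).sub (stronglyMeasurable_condExp.mono (ℱ.mono k.le_succ))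
  have hDL : ∀ s k, MemLp (D s k) 2 P := fun s k =>
    (hYL s k).sub ((hYL s k).condExp one_le_two)
  have hDc : ∀ s k, P[D s k | ℱ k] =ᵐ[P] 0 := fun s k => by
    have h1 := condExp_sub (hYi s k) (integrable_condExp (μ := P) (m := ℱ k) (f := Y s k)) (ℱ k)
    rw [condExp_of_stronglyMeasurable (ℱ.le k) stronglyMeasurable_condExp integrable_condExp] at h1
    filter_upwards [h1] with ω h1
    simp only [hD]
    rw [h1]
    simp
  have hcY : ∀ s k, P[Y s k | ℱ k] =ᵐ[P] (a ⁻¹' 𝒜).indicator fun ω =>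
      ∑ η', NormedSpace.exp (h • generator Q d (a ω)) (ξ (k * h) ω) η' *
        g s (ξ (k * h) ω) η' := fun s k => by
    have := hξ.condExp_indicator ha h𝒜 (hg1 s) (ht0 k) (htk k)
    rwa [htd k] at this
  have hcY2 : ∀ s k, P[Y s k ^ 2 | ℱ k] =ᵐ[P] (a ⁻¹' 𝒜).indicator fun ω =>
      ∑ η', NormedSpace.exp (h • generator Q d (a ω)) (ξ (k * h) ω) η' *
        g s (ξ (k * h) ω) η' ^ 2 := fun s k => by
    have := hξ.condExp_indicator ha h𝒜 (g := fun η η' => g s η η' ^ 2) (hg2 s) (ht0 k) (htk k)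
    rw [htd k] at this
    have hsq : Y s k ^ 2 = (a ⁻¹' 𝒜).indicator
        fun ω => g s (ξ (k * h) ω) (ξ ((k + 1 : ℕ) * h) ω) ^ 2 := by
      ext ω
      by_cases hω : ω ∈ a ⁻¹' 𝒜 <;> simp [hY, hω]
    rw [hsq]
    exact this
  have hv0 : 0 ≤ h * (C / N + τ) := by positivity
  -- The conditional variance is at most the conditional mean of Y². The expansion of the semigroup
  -- at the squared increment gives the quadratic variation rate C / N, up to the error τ.
  have hDv : ∀ s k, ∫ ω, D s k ω ^ 2 ∂P ≤ h * (C / N + τ) := fun s k => by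
    have h1 : ∫ ω, D s k ω ^ 2 ∂P = ∫ ω, Var[Y s k; P | ℱ k] ω ∂P := by
      rw [condVar, integral_condExp (ℱ.le k)]
      rfl
    rw [h1]
    have h2 : ∀ᵐ ω ∂P, Var[Y s k; P | ℱ k] ω ≤ h * (C / N + τ) := by
      filter_upwards [condVar_ae_le_condExp_sq (ℱ.le k) (hYL s k), hcY2 s k] with ω h3 h4
      refine h3.trans ?_
      rw [h4]
      by_cases hω : ω ∈ a ⁻¹' 𝒜
      · rw [Set.indicator_of_mem hω]
        have h5 := hexp (a ω) hω (fun η' => g s (ξ (k * h) ω) η' ^ 2) (hg2 s _) (ξ (k * h) ω)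
        have h6 := sum_generator_mul_sq_average_sub_le (Q := Q) (d := d) (a := a ω)
          (ξ (k * h) ω) s
        have h7 : g s (ξ (k * h) ω) (ξ (k * h) ω) = 0 := by simp [hg]
        have h8 : h * ∑ η', generator Q d (a ω) (ξ (k * h) ω) η' * g s (ξ (k * h) ω) η' ^ 2 ≤
            h * (C / N) := by
          refine mul_le_mul_of_nonneg_left (h6.trans ?_) hh.le
          rw [div_eq_inv_mul]
          exact mul_le_mul_of_nonneg_left (hrate _ hω _) (by positivity)
        rw [h7] at h5
        have := (abs_le.1 h5).2
        linarith
      · rw [Set.indicator_of_notMem hω]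
        exact hv0
    calc _ ≤ ∫ _ω, h * (C / N + τ) ∂P :=
          integral_mono_ae integrable_condVar (integrable_const _) h2
      _ = _ := by simp
  have hbad := fun s => prob_exists_sum_ge_le (hDm s) (hDL s) (hDc s) (hDv s) n hδ
  have hae : ∀ᵐ ω ∂P, ∀ s k, P[Y s k | ℱ k] ω = (a ⁻¹' 𝒜).indicator (fun ω =>
      ∑ η', NormedSpace.exp (h • generator Q d (a ω)) (ξ (k * h) ω) η' *
        g s (ξ (k * h) ω) η') ω :=
    ae_all_iff.2 fun s => ae_all_iff.2 fun k => hcY s k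
  calc _ ≤ P (⋃ s, {ω | ∃ k ≤ n, δ ≤ |∑ j ∈ Finset.range k, D s j ω|}) := by
        refine measure_mono_ae ?_
        filter_upwards [hae] with ω hω hmem
        obtain ⟨hA, h0, k, hk, hlt⟩ := hmem
        by_contra hnot
        have hsmall : ∀ s, ∀ k ≤ n, |∑ j ∈ Finset.range k, D s j ω| < δ := by
          intro s k hk
          by_contra hcon
          exact hnot (Set.mem_iUnion.2 ⟨s, k, hk, not_lt.1 hcon⟩)
        have hA' : ω ∈ a ⁻¹' 𝒜 := hA
        have hsx : ∀ k : ℕ, average (indicators (ξ (k * h) ω)) ∈ stdSimplex ℝ (Fin S) := fun k =>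
          average_mem_stdSimplex hN (indicators_mem_stdSimplex _)
        -- Off the bad events of the maximal inequality the densities follow a noisy Euler scheme:
        -- ε₁ is the environment error of the drift, τ that of the semigroup expansion.
        have key := norm_sub_le_of_discrete_recursion (n := n) (h := h) (K := K) (ε := ε₁ + τ)
          (δ₀ := δ) (δ₁ := δ) (x := fun k : ℕ => average (indicators (ξ (k * h) ω)))
          (u := fun k : ℕ => u (k * h)) (D := fun k s => D s k ω) (F := fun v => Q v *ᵥ v)
          hh.le hK (by positivity) ?_ ?_ ?_ ?_ ?_ hk
        · have : (δ + δ + n * h * (2 * (ε₁ + τ))) * Real.exp (K * (n * h)) ≤ ε := by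
            rwa [← two_mul]
          linarith
        · intro k _
          have hvec : ∀ s, |∑ η', NormedSpace.exp (h • generator Q d (a ω)) (ξ (k * h) ω) η' *
              g s (ξ (k * h) ω) η' - h * average (fun i => Q (environment d (a ω)
                (indicators (ξ (k * h) ω)) i) *ᵥ indicators (ξ (k * h) ω) i) s| ≤ τ * h := by
            intro s
            have h5 := hexp (a ω) hA (fun η' => g s (ξ (k * h) ω) η') (hg1 s _) (ξ (k * h) ω)
            have h7 : g s (ξ (k * h) ω) (ξ (k * h) ω) = 0 := by simp [hg]
            rw [h7, sub_zero] at h5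
            rwa [← sum_generator_mul_average_sub hQ]
          refine (pi_norm_le_iff_of_nonneg (by positivity)).2 fun s => ?_
          have hd1 := (norm_le_pi_norm _ s).trans (hdrift (a ω) hA (ξ (k * h) ω))
          have hd2 := hvec s
          have hDs : D s k ω = g s (ξ (k * h) ω) (ξ ((k + 1 : ℕ) * h) ω) -
              ∑ η', NormedSpace.exp (h • generator Q d (a ω)) (ξ (k * h) ω) η' *
                g s (ξ (k * h) ω) η' := by
            simp only [hD, Pi.sub_apply]
            rw [hω s k, Set.indicator_of_mem hA']
            simp only [hY, Set.indicator_of_mem hA']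
          simp only [Pi.sub_apply, Pi.smul_apply, smul_eq_mul, Real.norm_eq_abs] at hd1 ⊢
          rw [hDs]
          simp only [hg] at hd2 ⊢
          rw [abs_le] at hd1 hd2 ⊢
          constructor <;> nlinarith
        · intro k hk
          refine (hu k hk).trans ?_
          gcongr
          linarith
        · intro k _
          exact hF _ (hsx k) _ (hus _ (ht0 k))
        · intro k hk
          refine (pi_norm_le_iff_of_nonneg hδ.le).2 fun s => ?_
          rw [Finset.sum_apply]
          exact (hsmall s k hk).le
        · simpa using h0
    _ ≤ ∑ s, P {ω | ∃ k ≤ n, δ ≤ |∑ j ∈ Finset.range k, D s j ω|} :=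
        measure_iUnion_fintype_le _ _
    _ ≤ ∑ _s : Fin S, ENNReal.ofReal (n * (h * (C / N + τ)) / δ ^ 2) :=
        Finset.sum_le_sum fun s _ => hbad s
    _ = _ := by simp

end LocalDensity

-- Euler steps and dyadic times

theorem IsMeanFieldSolution.continuousOn {S : ℕ} {Q : (Fin S → ℝ) → Matrix (Fin S) (Fin S) ℝ}
    {u : ℝ → Fin S → ℝ} (hu : IsMeanFieldSolution Q u) : ContinuousOn u (Set.Ici 0) :=
  fun t ht => (hu.ode t ht).continuousWithinAt

/-- The error of one Euler step for the mean-field equation. -/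
theorem IsMeanFieldSolution.norm_step_le {S : ℕ} {Q : (Fin S → ℝ) → Matrix (Fin S) (Fin S) ℝ}
    {u : ℝ → Fin S → ℝ} (hu : IsMeanFieldSolution Q u) {K C : ℝ} (hK : 0 ≤ K) (hC0 : 0 ≤ C)
    (hus : ∀ t, 0 ≤ t → u t ∈ stdSimplex ℝ (Fin S))
    (hF : ∀ v ∈ stdSimplex ℝ (Fin S), ∀ v' ∈ stdSimplex ℝ (Fin S),
      ‖Q v *ᵥ v - Q v' *ᵥ v'‖ ≤ K * ‖v - v'‖)
    (hC : ∀ v ∈ stdSimplex ℝ (Fin S), ‖Q v *ᵥ v‖ ≤ C) {t h : ℝ} (ht : 0 ≤ t) (hh : 0 ≤ h) :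
    ‖u (t + h) - u t - h • (Q (u t) *ᵥ u t)‖ ≤ h * (K * C * h) := by
  have hsub : Set.Icc t (t + h) ⊆ Set.Ici 0 := fun r hr => ht.trans hr.1
  have hd : ∀ r ∈ Set.Ico t (t + h), HasDerivWithinAt u (Q (u r) *ᵥ u r) (Set.Ici r) r :=
    fun r hr => (hu.ode r (ht.trans hr.1)).mono (Set.Ici_subset_Ici.2 (ht.trans hr.1))
  have h1 : ∀ r ∈ Set.Icc t (t + h), ‖u r - u t‖ ≤ C * (r - t) :=
    norm_image_sub_le_of_norm_deriv_right_le_segment (hu.continuousOn.mono hsub) hd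
      fun r hr => hC _ (hus r (ht.trans hr.1))
  -- The mean value inequality after subtracting the tangent line; the derivative of the difference
  -- is at most K C h, since u moves by at most C h.
  have h2 := norm_image_sub_le_of_norm_deriv_right_le_segment (a := t) (b := t + h)
    (f := fun r => u r - (r - t) • (Q (u t) *ᵥ u t))
    (f' := fun r => Q (u r) *ᵥ u r - Q (u t) *ᵥ u t) (C := K * C * h)
    ((hu.continuousOn.mono hsub).sub (by fun_prop))
    (fun r hr => by
      refine (hd r hr).sub ?_
      have := (((hasDerivAt_id r).sub_const t).smul_const (Q (u t) *ᵥ u t)).hasDerivWithinAt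
        (s := Set.Ici r)
      simpa using this)
    (fun r hr => by
      have h3 := h1 r ⟨hr.1, hr.2.le⟩
      calc _ ≤ K * ‖u r - u t‖ := hF _ (hus r (ht.trans hr.1)) _ (hus t ht)
        _ ≤ K * (C * h) := by
            gcongr
            refine h3.trans ?_
            gcongr
            linarith [hr.2]
        _ = _ := by ring)
    (t + h) ⟨by linarith, le_rfl⟩
  simp only [add_sub_cancel_left, sub_self, zero_smul, sub_zero] at h2
  calc _ = ‖u (t + h) - h • (Q (u t) *ᵥ u t) - u t‖ := by congr 1; abel
    _ ≤ _ := h2.trans (by rw [mul_comm])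

/-- A property that propagates to the right of a time in `[0, T]` holds at a dyadic time. -/
theorem exists_dyadic_of_eventually {p : ℝ → Prop} {T t : ℝ} (hT : 0 < T) (ht : t ∈ Set.Icc 0 T)
    (hp : p t) (hev : ∀ᶠ r in 𝓝[>] t, p r) : ∃ m k : ℕ, k ≤ 2 ^ m ∧ p (k * (T / 2 ^ m)) := by
  -- The endpoint T is itself a grid point; there the property to the right of T would give no
  -- admissible time.
  rcases ht.2.eq_or_lt with rfl | htT
  · exact ⟨0, 1, by simp, by simpa using hp⟩
  obtain ⟨t', ht', hsub⟩ := mem_nhdsGT_iff_exists_Ioo_subset.1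
    (inter_mem hev (Ioo_mem_nhdsGT htT))
  have ht'0 : 0 < t' - t := sub_pos.2 ht'
  obtain ⟨m, hm⟩ := pow_unbounded_of_one_lt (T / (t' - t)) one_lt_two
  have h2 : (0 : ℝ) < 2 ^ m := by positivity
  have hstep : 0 < T / 2 ^ m := by positivity
  have hlt : T / 2 ^ m < t' - t := by
    rw [div_lt_iff₀ ht'0] at hm
    rw [div_lt_iff₀ h2]
    linarith
  set k := ⌊t / (T / 2 ^ m)⌋₊ with hk
  have h0 : 0 ≤ t / (T / 2 ^ m) := div_nonneg ht.1 hstep.le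
  have hk1 : (k : ℝ) * (T / 2 ^ m) ≤ t := by
    rw [← le_div_iff₀ hstep]
    exact Nat.floor_le h0
  have hk2 : t < ((k + 1 : ℕ) : ℝ) * (T / 2 ^ m) := by
    rw [← div_lt_iff₀ hstep]
    push_cast
    exact Nat.lt_floor_add_one _
  -- The index is k + 1 because the k-th grid point may lie at or to the left of t.
  have hmem : ((k + 1 : ℕ) : ℝ) * (T / 2 ^ m) ∈ Set.Ioo t t' := by
    refine ⟨hk2, ?_⟩
    push_cast
    linarith
  have hgood := hsub hmem
  refine ⟨m, k + 1, ?_, hgood.1⟩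
  have hle := hgood.2.2.le
  rw [mul_div_assoc', div_le_iff₀ h2, mul_comm T] at hle
  exact_mod_cast le_of_mul_le_mul_right hle hT

-- From the grid to all times

section LocalDensity

variable {Ω : Type*} [mΩ : MeasurableSpace Ω] {P : Measure Ω} [IsProbabilityMeasure P] {N S : ℕ}
  {Q : (Fin S → ℝ) → Matrix (Fin S) (Fin S) ℝ} {d : ℝ} {a : Ω → Fin N → Fin N → ℝ}
  {ξ : ℝ → Ω → Config N S}

/-- The grid bound does not depend on the mesh, so it passes to the increasing union over dyadic
grids. The bound `R` on the entries only makes the semigroup expansion uniform over `𝒜`, and it does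
not enter the estimate. -/
theorem IsLocalDensityProcess.prob_exists_le_of_bounded (hQ : IsRateFunction Q)
    (hQlip : ∀ k s, LocallyLipschitz fun φ => Q φ k s) (hN : N ≠ 0) (ha : Measurable a)
    (hξ : IsLocalDensityProcess P Q d a ξ) {𝒜 : Set (Fin N → Fin N → ℝ)} (h𝒜 : MeasurableSet 𝒜)
    {R : ℝ} (hR : ∀ a ∈ 𝒜, ∀ i j, |a i j| ≤ R)
    {u : ℝ → Fin S → ℝ} (hu : IsMeanFieldSolution Q u) {T ε₁ C K δ ε : ℝ} (hT : 0 < T)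
    (hε₁ : 0 ≤ ε₁) (hC : 0 ≤ C) (hK : 0 ≤ K) (hδ : 0 < δ)
    (hdrift : ∀ a ∈ 𝒜, ∀ η : Config N S,
      ‖average (fun i => Q (environment d a (indicators η) i) *ᵥ indicators η i) -
        Q (average (indicators η)) *ᵥ average (indicators η)‖ ≤ ε₁)
    (hrate : ∀ a ∈ 𝒜, ∀ η : Config N S,
      (N : ℝ)⁻¹ * ∑ i, ∑ k, |Q (environment d a (indicators η) i) k (η i)| ≤ C)
    (hF : ∀ v ∈ stdSimplex ℝ (Fin S), ∀ v' ∈ stdSimplex ℝ (Fin S),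
      ‖Q v *ᵥ v - Q v' *ᵥ v'‖ ≤ K * ‖v - v'‖)
    (hε : (2 * δ + T * (2 * (ε₁ + (N : ℝ)⁻¹))) * Real.exp (K * T) ≤ ε) :
    P {ω | a ω ∈ 𝒜 ∧ ‖average (indicators (ξ 0 ω)) - u 0‖ ≤ δ ∧
        ∃ t ∈ Set.Icc 0 T, ε < ‖average (indicators (ξ t ω)) - u t‖} ≤
      S * ENNReal.ofReal (T * ((C + 1) / N) / δ ^ 2) := by
  have hN0 : (0 : ℝ) < N := by exact_mod_cast Nat.pos_of_ne_zero hN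
  have hus : ∀ t, 0 ≤ t → u t ∈ stdSimplex ℝ (Fin S) := fun t ht =>
    hu.mem_stdSimplex hQ hQlip ht
  obtain ⟨B, hB0, hB⟩ := exists_bound_of_isCompact hQlip (isCompact_stdSimplex ℝ (Fin S))
  obtain ⟨B', hB'0, hB'⟩ := exists_bound_of_isCompact hQlip
    (isCompact_closedBall (0 : Fin S → ℝ) (|d⁻¹| * (∑ _i : Fin N, ∑ _j : Fin N, R)))
  have hFC : ∀ v ∈ stdSimplex ℝ (Fin S), ‖Q v *ᵥ v‖ ≤ S * (B * 1) := fun v hv =>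
    norm_mulVec_le_of_entry_le zero_le_one hB0 (fun k s => hB k s v hv)
      (abs_le_one_of_mem_stdSimplex hv)
  have hgen : ∀ a ∈ 𝒜, ∀ η η' : Config N S, |generator Q d a η η'| ≤ N * B' := by
    intro a ha
    refine abs_generator_le hB'0 fun η i k s => hB' k s _ ?_
    rw [mem_closedBall_zero_iff]
    refine (norm_environment_le d a _ i).trans ?_
    have h1 : ‖indicators η‖ ≤ 1 := (pi_norm_le_iff_of_nonneg zero_le_one).2 fun j =>
      (pi_norm_le_iff_of_nonneg zero_le_one).2 fun s =>
        abs_le_one_of_mem_stdSimplex (indicators_mem_stdSimplex η j) s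
    refine (mul_le_of_le_one_right (by positivity) h1).trans ?_
    gcongr with i _ j _
    exact hR a ha i j
  obtain ⟨h₀, hh₀, hexp⟩ := exists_exp_expansion (n := Config N S) (N * B') (inv_pos.2 hN0)
  set Z : ℝ → Ω → ℝ := fun t ω => ‖average (indicators (ξ t ω)) - u t‖ with hZ
  set A : ℕ → Set Ω := fun m => {ω | a ω ∈ 𝒜 ∧ Z 0 ω ≤ δ ∧
    ∃ k : ℕ, k ≤ 2 ^ m ∧ ε < Z (k * (T / 2 ^ m)) ω} with hA
  have hmono : Monotone A := by
    refine monotone_nat_of_le_succ fun m => ?_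
    rintro ω ⟨h1, h2, k, hk, h3⟩
    refine ⟨h1, h2, 2 * k, by rw [pow_succ]; omega, ?_⟩
    convert h3 using 2
    push_cast
    field_simp
    ring
  have hbound : ∀ m, P (A m) ≤ S * ENNReal.ofReal (T * ((C + 1) / N) / δ ^ 2) := by
    intro m
    set c : ℝ := K * (S * (B * 1)) with hc
    have hc0 : 0 ≤ c := by positivity
    have hlim : Tendsto (fun l : ℕ => T / (2 : ℝ) ^ l) atTop (𝓝 0) :=
      Tendsto.const_div_atTop (tendsto_pow_atTop_atTop_of_one_lt one_lt_two) T
    have hpos : 0 < (N : ℝ)⁻¹ / (c + 1) := by positivity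
    -- The grid is refined until both the semigroup error and the Euler error per unit time are at
    -- most τ = 1/N.
    obtain ⟨l, hml, hl1, hl2⟩ := ((eventually_ge_atTop m).and
      ((hlim.eventually (gt_mem_nhds hh₀)).and (hlim.eventually (gt_mem_nhds hpos)))).exists
    refine (measure_mono (hmono hml)).trans ?_
    have hh : 0 < T / (2 : ℝ) ^ l := by positivity
    have hch : c * (T / 2 ^ l) ≤ (N : ℝ)⁻¹ := by
      rw [lt_div_iff₀ (by positivity)] at hl2
      linarith
    have hTn : ((2 ^ l : ℕ) : ℝ) * (T / 2 ^ l) = T := by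
      push_cast
      field_simp
    have := hξ.prob_grid_le hQ hN ha h𝒜 (u := u) (n := 2 ^ l) (h := T / 2 ^ l) (τ := (N : ℝ)⁻¹)
      (ε := ε) hh (by positivity) hε₁ hC hK hδ (fun a ha g hg η => hexp _ hh hl1 _ (hgen a ha) g hg η)
      hdrift hrate hF hus (fun k _ => by
        have h1 := hu.norm_step_le hK (by positivity) hus hF hFC (t := k * (T / 2 ^ l))
          (by positivity) hh.le
        have h2 : ((k + 1 : ℕ) : ℝ) * (T / 2 ^ l) = k * (T / 2 ^ l) + T / 2 ^ l := by
          push_cast; ring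
        rw [h2]
        exact h1.trans (by gcongr)) (by rwa [hTn])
    rw [← mul_assoc, hTn] at this
    have he : (C + 1) / N = C / N + (N : ℝ)⁻¹ := by rw [add_div, one_div]
    rw [he]
    convert this using 6
  calc _ ≤ P (⋃ m, A m) := by
        refine measure_mono_ae ?_
        filter_upwards [hξ.right_cont] with ω hω hmem
        obtain ⟨h1, h2, t, ht, h3⟩ := hmem
        -- The chain is constant just after t and u is continuous, so the strict inequality persists
        -- to the right.
        have hev : ∀ᶠ r in 𝓝[>] t, ε < Z r ω := by
          have hcont : Tendsto (fun r => ‖average (indicators (ξ t ω)) - u r‖) (𝓝[>] t)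
              (𝓝 ‖average (indicators (ξ t ω)) - u t‖) := by
            refine (tendsto_const_nhds.sub ?_).norm
            exact ((hu.continuousOn t ht.1).mono
              (Set.Ioi_subset_Ici_self.trans (Set.Ici_subset_Ici.2 ht.1)))
          filter_upwards [hω t ht.1, hcont.eventually (lt_mem_nhds h3)] with r hr1 hr2
          simp only [hZ, hr1]
          exact hr2
        obtain ⟨m, k, hk, hZk⟩ := exists_dyadic_of_eventually (p := fun r => ε < Z r ω) hT ht h3 hev
        exact Set.mem_iUnion.2 ⟨m, h1, h2, k, hk, hZk⟩
    _ = ⨆ m, P (A m) := hmono.measure_iUnion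
    _ ≤ _ := iSup_le hbound

/-- The probability that the densities leave the neighbourhood of the mean-field solution, on a
set of graphs whose averaged drift is close to the mean-field one. -/
theorem IsLocalDensityProcess.prob_exists_le (hQ : IsRateFunction Q)
    (hQlip : ∀ k s, LocallyLipschitz fun φ => Q φ k s) (hN : N ≠ 0) (ha : Measurable a)
    (hξ : IsLocalDensityProcess P Q d a ξ) {𝒜 : Set (Fin N → Fin N → ℝ)} (h𝒜 : MeasurableSet 𝒜)
    {u : ℝ → Fin S → ℝ} (hu : IsMeanFieldSolution Q u) {T ε₁ C K δ ε : ℝ} (hT : 0 < T)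
    (hε₁ : 0 ≤ ε₁) (hC : 0 ≤ C) (hK : 0 ≤ K) (hδ : 0 < δ)
    (hdrift : ∀ a ∈ 𝒜, ∀ η : Config N S,
      ‖average (fun i => Q (environment d a (indicators η) i) *ᵥ indicators η i) -
        Q (average (indicators η)) *ᵥ average (indicators η)‖ ≤ ε₁)
    (hrate : ∀ a ∈ 𝒜, ∀ η : Config N S,
      (N : ℝ)⁻¹ * ∑ i, ∑ k, |Q (environment d a (indicators η) i) k (η i)| ≤ C)
    (hF : ∀ v ∈ stdSimplex ℝ (Fin S), ∀ v' ∈ stdSimplex ℝ (Fin S),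
      ‖Q v *ᵥ v - Q v' *ᵥ v'‖ ≤ K * ‖v - v'‖)
    (hε : (2 * δ + T * (2 * (ε₁ + (N : ℝ)⁻¹))) * Real.exp (K * T) ≤ ε) :
    P {ω | a ω ∈ 𝒜 ∧ ‖average (indicators (ξ 0 ω)) - u 0‖ ≤ δ ∧
        ∃ t ∈ Set.Icc 0 T, ε < ‖average (indicators (ξ t ω)) - u t‖} ≤
      S * ENNReal.ofReal (T * ((C + 1) / N) / δ ^ 2) := by
  -- Exhausting `𝒜` by bounded graphs removes the assumption on the entries, as the bound is the
  -- same for every l.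
  set ℬ : ℕ → Set (Fin N → Fin N → ℝ) := fun l => {a | ∀ i j, |a i j| ≤ l} with hℬ
  have hℬm : ∀ l, MeasurableSet (ℬ l) := fun l => by
    have : ℬ l = ⋂ i, ⋂ j, {a : Fin N → Fin N → ℝ | |a i j| ≤ (l : ℝ)} := by ext; simp [hℬ]
    rw [this]
    refine MeasurableSet.iInter fun i => MeasurableSet.iInter fun j => ?_
    have hm : Measurable fun a : Fin N → Fin N → ℝ => |a i j| := by fun_prop
    exact measurableSet_le hm measurable_const
  set A : ℕ → Set Ω := fun l => {ω | a ω ∈ 𝒜 ∩ ℬ l ∧ ‖average (indicators (ξ 0 ω)) - u 0‖ ≤ δ ∧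
        ∃ t ∈ Set.Icc 0 T, ε < ‖average (indicators (ξ t ω)) - u t‖} with hA
  have hmono : Monotone A := by
    rintro l l' hl ω ⟨h1, h2⟩
    refine ⟨⟨h1.1, fun i j => (h1.2 i j).trans ?_⟩, h2⟩
    exact_mod_cast hl
  calc _ ≤ P (⋃ l, A l) := by
        refine measure_mono ?_
        rintro ω ⟨h1, h2⟩
        obtain ⟨l, hl⟩ := exists_nat_ge (∑ i, ∑ j, |a ω i j|)
        refine Set.mem_iUnion.2 ⟨l, ⟨h1, fun i j => le_trans ?_ hl⟩, h2⟩
        calc |a ω i j| ≤ ∑ j, |a ω i j| :=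
              Finset.single_le_sum (f := fun j => |a ω i j|) (fun _ _ => abs_nonneg _)
                (Finset.mem_univ j)
          _ ≤ _ := Finset.single_le_sum (f := fun i => ∑ j, |a ω i j|)
                (fun _ _ => by positivity) (Finset.mem_univ i)
    _ = ⨆ l, P (A l) := hmono.measure_iUnion
    _ ≤ _ := iSup_le fun l => hξ.prob_exists_le_of_bounded hQ hQlip hN ha (h𝒜.inter (hℬm l))
        (fun a ha => ha.2) hu hT hε₁ hC hK hδ (fun a ha => hdrift a ha.1)
        (fun a ha => hrate a ha.1) hF hε

end LocalDensity

-- Comparison of the 1-norm with the sup norm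

theorem ofReal_norm_sub_le_dist1 {S : ℕ} (v v' : Fin S → ℝ) :
    ENNReal.ofReal ‖v - v'‖ ≤ dist1 v v' := by
  refine ENNReal.ofReal_le_ofReal ?_
  refine (pi_norm_le_iff_of_nonneg (by positivity)).2 fun s => ?_
  exact Finset.single_le_sum (f := fun s => |v s - v' s|) (fun _ _ => abs_nonneg _)
    (Finset.mem_univ s)

theorem dist1_le_ofReal {S : ℕ} {v v' : Fin S → ℝ} {r : ℝ} (h : ‖v - v'‖ ≤ r) :
    dist1 v v' ≤ ENNReal.ofReal (S * r) := by
  refine ENNReal.ofReal_le_ofReal ?_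
  calc ∑ s, |v s - v' s| ≤ ∑ _s : Fin S, r :=
        Finset.sum_le_sum fun s _ => (norm_le_pi_norm (v - v') s).trans h
    _ = _ := by simp

theorem exists_norm_bound_of_le_supDist (S : ℕ) {ε : ℝ≥0∞} (hε : 0 < ε) :
    ∃ r : ℝ, 0 < r ∧ ∀ (T : ℝ) (v v' : ℝ → Fin S → ℝ), ε ≤ supDist T v v' →
      ∃ t ∈ Set.Icc 0 T, r < ‖v t - v' t‖ := by
  have hlim : Tendsto (fun r : ℝ => ENNReal.ofReal (S * r)) (𝓝[>] 0) (𝓝 0) := by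
    have h1 : Tendsto (fun r : ℝ => ENNReal.ofReal (S * r)) (𝓝 0) (𝓝 (ENNReal.ofReal (S * 0))) :=
      ((ENNReal.continuous_ofReal.comp (by fun_prop)).tendsto _)
    simp only [mul_zero, ENNReal.ofReal_zero] at h1
    exact h1.mono_left nhdsWithin_le_nhds
  -- Choosing r by a limit also covers S = 0 and ε = ∞.
  obtain ⟨r, hr, hr0⟩ := ((hlim.eventually (gt_mem_nhds hε)).and self_mem_nhdsWithin).exists
  refine ⟨r, hr0, fun T v v' h => ?_⟩
  by_contra! hcon
  have : supDist T v v' ≤ ENNReal.ofReal (S * r) :=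
    iSup₂_le fun t ht => dist1_le_ofReal (hcon t ht)
  exact absurd (h.trans this) (not_le.2 hr)

-- Convergence in probability under Lipschitz rates

/-- The two Markov bounds are of orders 1/(Np) and 1/(Np²); since p ≤ 1, the hypothesis on Np²
controls both. -/
theorem tendsto_prob_not_nearlyHomogeneous {Ω : ℕ → Type*} [∀ N, MeasurableSpace (Ω N)]
    {P : ∀ N, Measure (Ω N)} [∀ N, IsProbabilityMeasure (P N)] {ν : Measure ℝ} {p : ℕ → ℝ}
    {w b : ∀ N, Edge N → Ω N → ℝ} (hG : ∀ N, IsWeightedErdosRenyi (P N) ν (p N) (w N) (b N))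
    (hν : MemLp id 2 ν) (hμ : 0 < ∫ x, x ∂ν)
    (hp : Tendsto (fun N : ℕ => (N : ℝ) * p N ^ 2) atTop atTop) {κ : ℝ} (hκ : 0 < κ) :
    Tendsto (fun N => P N {ω | adj (fun e => w N e ω) (fun e => b N e ω) ∉
      nearlyHomogeneous N (avgDegree N (p N) (∫ x, x ∂ν)) κ}) atTop (𝓝 0) := by
  have hp' : Tendsto (fun N : ℕ => (N : ℝ) * p N) atTop atTop := by
    refine tendsto_atTop_mono (fun N => ?_) hp
    have := (hG N).p_mem
    gcongr
    nlinarith [this.1, this.2]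
  set c := 4 * (∫ x, x ^ 2 ∂ν) / (∫ x, x ∂ν) ^ 2 with hc
  have h1 : Tendsto (fun N : ℕ => ENNReal.ofReal (c / (N * p N) / κ)) atTop (𝓝 0) := by
    have := ENNReal.tendsto_ofReal ((hp'.const_div_atTop c).div_const κ)
    simpa using this
  have h2 : Tendsto (fun N : ℕ => ENNReal.ofReal (c ^ 2 / (N * p N ^ 2) / κ ^ 2)) atTop (𝓝 0) := by
    have := ENNReal.tendsto_ofReal ((hp.const_div_atTop (c ^ 2)).div_const (κ ^ 2))
    simpa using this
  have h3 := h1.add h2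
  rw [add_zero] at h3
  refine tendsto_of_tendsto_of_tendsto_of_le_of_le' tendsto_const_nhds h3
    (Eventually.of_forall fun _ => zero_le) ?_
  filter_upwards [eventually_ge_atTop 2, hp'.eventually_gt_atTop 0] with N hN hpN
  have hp0 : 0 < p N := by
    have : (0 : ℝ) < N := by positivity
    exact pos_of_mul_pos_right hpN this.le
  exact (hG N).prob_not_nearlyHomogeneous hν hμ hN hp0 hκ

theorem TendstoZeroInProbability.tendsto_prob_norm {Ω : ℕ → Type*} [∀ N, MeasurableSpace (Ω N)]
    {P : ∀ N, Measure (Ω N)} {S : ℕ} {x : ∀ N, Ω N → Fin S → ℝ} {v : Fin S → ℝ}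
    (h : TendstoZeroInProbability P fun N ω => dist1 (x N ω) v) {δ : ℝ} (hδ : 0 < δ) :
    Tendsto (fun N => P N {ω | ¬ ‖x N ω - v‖ ≤ δ}) atTop (𝓝 0) := by
  refine tendsto_of_tendsto_of_tendsto_of_le_of_le tendsto_const_nhds
    (h (ENNReal.ofReal δ) (ENNReal.ofReal_pos.2 hδ)) (fun _ => zero_le) fun N => measure_mono ?_
  intro ω hω
  exact (ENNReal.ofReal_le_ofReal (not_le.1 hω).le).trans (ofReal_norm_sub_le_dist1 _ _)

/-- The convergence theorem for graphs whose environments stay, with high probability, in a set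
on which the rates are Lipschitz. -/
theorem tendstoZeroInProbability_of_lipschitzRates {S : ℕ}
    {Q : (Fin S → ℝ) → Matrix (Fin S) (Fin S) ℝ} (hQ : IsRateFunction Q)
    (hQlip : ∀ k s, LocallyLipschitz fun φ => Q φ k s)
    {ν : Measure ℝ} (hν_nonneg : ∀ᵐ x ∂ν, 0 ≤ x)
    (hν_memLp : MemLp id 2 ν) (hν_pos : 0 < ∫ x, x ∂ν)
    {p : ℕ → ℝ} {Ω : ℕ → Type*} [∀ N, MeasurableSpace (Ω N)] {P : ∀ N, Measure (Ω N)}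
    [∀ N, IsProbabilityMeasure (P N)] {w b : ∀ N, Edge N → Ω N → ℝ}
    (hG : ∀ N, IsWeightedErdosRenyi (P N) ν (p N) (w N) (b N))
    {ξ : ∀ N, ℝ → Ω N → Config N S}
    (hξ : ∀ N, IsLocalDensityProcess (P N) Q (avgDegree N (p N) (∫ x, x ∂ν))
      (fun ω => adj (fun e => w N e ω) (fun e => b N e ω)) (ξ N))
    {z : ∀ N, Ω N → ℝ → Fin N → Fin S → ℝ}
    (hz : ∀ N, ∀ᵐ ω ∂(P N), IsNIMFA Q (avgDegree N (p N) (∫ x, x ∂ν))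
      (adj (fun e => w N e ω) (fun e => b N e ω)) (z N ω))
    {u : ℝ → Fin S → ℝ} (hu : IsMeanFieldSolution Q u)
    (hx0 : TendstoZeroInProbability P fun N ω => dist1 (average (indicators (ξ N 0 ω))) (u 0))
    (hy0 : TendstoZeroInProbability P fun N ω => dist1 (average (z N ω 0)) (u 0))
    {D : Set (Fin S → ℝ)} {L : ℝ} (hL0 : 0 ≤ L) (hL : LipschitzRates Q D L)
    (hD : stdSimplex ℝ (Fin S) ⊆ D) {𝒟 : ∀ N, Set (Fin N → Fin N → ℝ)}
    (h𝒟m : ∀ N, MeasurableSet (𝒟 N))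
    (h𝒟 : ∀ N, ∀ a ∈ 𝒟 N, ∀ v : Fin N → Fin S → ℝ, (∀ i, v i ∈ stdSimplex ℝ (Fin S)) →
      ∀ i, environment (avgDegree N (p N) (∫ x, x ∂ν)) a v i ∈ D)
    (h𝒟P : Tendsto (fun N => P N {ω | adj (fun e => w N e ω) (fun e => b N e ω) ∉ 𝒟 N})
      atTop (𝓝 0))
    (hNp : Tendsto (fun N : ℕ => (N : ℝ) * p N ^ 2) atTop atTop) {T : ℝ} (hT : 0 < T) :
    TendstoZeroInProbability P
        (fun N ω => supDist T (fun t => average (indicators (ξ N t ω))) u) ∧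
      TendstoZeroInProbability P (fun N ω => supDist T (fun t => average (z N ω t)) u) := by
  obtain ⟨B, hB0, hB⟩ := exists_bound_of_isCompact hQlip (isCompact_stdSimplex ℝ (Fin S))
  set K : ℝ := S * (L + B) with hK
  have hK0 : 0 ≤ K := by positivity
  have main : ∀ r : ℝ, 0 < r →
      Tendsto (fun N => P N {ω | ∃ t ∈ Set.Icc 0 T,
        r < ‖average (indicators (ξ N t ω)) - u t‖}) atTop (𝓝 0) ∧
      Tendsto (fun N => P N {ω | ∃ t ∈ Set.Icc 0 T,
        r < ‖average (z N ω t) - u t‖}) atTop (𝓝 0) := by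
    intro r hr
    set E : ℝ := Real.exp (K * T) with hE
    have hE0 : 0 < E := Real.exp_pos _
    -- With this δ the Grönwall bound tends to r/2, hence is eventually below r.
    set δ : ℝ := r / (2 * ((2 + T * (2 * (S * L * S))) * E)) with hδ
    have hden : 0 < (2 + T * (2 * (S * L * S))) * E := by positivity
    have hδ0 : 0 < δ := by positivity
    -- Chosen so that √(2κ), the main term of `deviation_le`, equals δ.
    set κ : ℝ := δ ^ 2 / 2 with hκ
    have hκ0 : 0 < κ := by positivity
    have hsqrt : √(2 * κ) = δ := by
      rw [hκ, mul_div_cancel₀ _ two_ne_zero, Real.sqrt_sq hδ0.le]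
    set R : ℕ → ℝ := fun N => S * (δ + 2 / ((N : ℝ) - 1)) with hR
    have hinv : Tendsto (fun N : ℕ => 2 / ((N : ℝ) - 1)) atTop (𝓝 0) :=
      (tendsto_atTop_add_const_right _ (-1) tendsto_natCast_atTop_atTop).const_div_atTop 2
    have hRlim : Tendsto (fun N : ℕ => (2 * δ + T * (2 * (S * L * R N + (N : ℝ)⁻¹))) * E) atTop
        (𝓝 ((2 * δ + T * (2 * (S * L * (S * (δ + 0)) + 0))) * E)) := by
      have h1 : Tendsto R atTop (𝓝 (S * (δ + 0))) := (hinv.const_add δ).const_mul _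
      exact ((((h1.const_mul _).add tendsto_inv_atTop_nhds_zero_nat).const_mul 2).const_mul T
        |>.const_add _).mul_const E
    have hlt : (2 * δ + T * (2 * (S * L * (S * (δ + 0)) + 0))) * E < r := by
      have : (2 * δ + T * (2 * (S * L * (S * (δ + 0)) + 0))) * E =
          δ * ((2 + T * (2 * (S * L * S))) * E) := by ring
      rw [this, hδ, div_mul_eq_mul_div, div_lt_iff₀ (by positivity)]
      nlinarith [mul_pos hr hden]
    -- A bound on the mean rate valid for all N ≥ 2, from R N ≤ S (δ + 2).
    set C : ℝ := S * (B + L * (S * (δ + 2))) with hC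
    have hC0 : 0 ≤ C := by positivity
    have hnh := tendsto_prob_not_nearlyHomogeneous hG hν_memLp hν_pos hNp hκ0
    have hdev : ∀ N : ℕ, 2 ≤ N → ∀ a ∈ 𝒟 N ∩ nearlyHomogeneous N
        (avgDegree N (p N) (∫ x, x ∂ν)) κ ∩ {a | ∀ i, a i i = 0},
        ∀ v : Fin N → Fin S → ℝ, (∀ i, v i ∈ stdSimplex ℝ (Fin S)) →
        deviation (avgDegree N (p N) (∫ x, x ∂ν)) a v ≤ R N := by
      intro N hN a ha v hv
      have := deviation_le_of_mem_nearlyHomogeneous hN hκ0.le ha.2 ha.1.2 hv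
      rwa [hsqrt] at this
    have hR0 : ∀ N : ℕ, 2 ≤ N → 0 ≤ R N ∧ R N ≤ S * (δ + 2) := by
      intro N hN
      have hN2 : (2 : ℝ) ≤ N := by exact_mod_cast hN
      have hN1 : (0 : ℝ) < N - 1 := by linarith
      refine ⟨by positivity, ?_⟩
      simp only [hR]
      gcongr
      rw [div_le_iff₀ hN1]
      linarith
    have hmem : ∀ N (ω : Ω N), adj (fun e => w N e ω) (fun e => b N e ω) ∈ 𝒟 N →
        adj (fun e => w N e ω) (fun e => b N e ω) ∈ nearlyHomogeneous N
          (avgDegree N (p N) (∫ x, x ∂ν)) κ →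
        adj (fun e => w N e ω) (fun e => b N e ω) ∈ 𝒟 N ∩ nearlyHomogeneous N
          (avgDegree N (p N) (∫ x, x ∂ν)) κ ∩ {a | ∀ i, a i i = 0} :=
      fun N ω h1 h2 => ⟨⟨h1, h2⟩, fun i => adj_self _ _ i⟩
    have h0m : ∀ N, MeasurableSet {a : Fin N → Fin N → ℝ | ∀ i, a i i = 0} := fun N => by
      have : {a : Fin N → Fin N → ℝ | ∀ i, a i i = 0} = ⋂ i, {a | a i i = 0} := by ext; simp
      rw [this]
      refine MeasurableSet.iInter fun i => ?_
      have hm : Measurable fun a : Fin N → Fin N → ℝ => a i i := by fun_prop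
      exact hm (measurableSet_singleton 0)
    constructor
    · have hcore : Tendsto (fun N : ℕ => (S : ℝ≥0∞) *
          ENNReal.ofReal (T * ((C + 1) / N) / δ ^ 2)) atTop (𝓝 0) := by
        have h1 : Tendsto (fun N : ℕ => T * ((C + 1) / N) / δ ^ 2) atTop
            (𝓝 (T * 0 / δ ^ 2)) :=
          ((tendsto_const_div_atTop_nhds_zero_nat (C + 1)).const_mul T).div_const _
        have h2 := ENNReal.Tendsto.const_mul (a := (S : ℝ≥0∞)) (ENNReal.tendsto_ofReal h1)
          (Or.inr (by simp))
        simpa using h2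
      have hsum := ((h𝒟P.add hnh).add (hx0.tendsto_prob_norm hδ0)).add hcore
      simp only [add_zero] at hsum
      refine tendsto_of_tendsto_of_tendsto_of_le_of_le' tendsto_const_nhds hsum
        (Eventually.of_forall fun _ => zero_le) ?_
      filter_upwards [eventually_ge_atTop 2, hRlim.eventually (gt_mem_nhds hlt)] with N hN hNr
      have hN0 : N ≠ 0 := by omega
      have hc := (hξ N).prob_exists_le hQ hQlip hN0 (measurable_adj (hG N))
        (((h𝒟m N).inter (measurableSet_nearlyHomogeneous N _ κ)).inter (h0m N)) hu hT
        (ε₁ := S * L * R N) (C := C) (K := K) (δ := δ) (ε := r)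
        (mul_nonneg (by positivity) (hR0 N hN).1) hC0 hK0 hδ0
        (fun a ha η => by
          have hv := indicators_mem_stdSimplex η
          refine (norm_average_drift_sub_le hL0 hL hD hN0 hv (h𝒟 N a ha.1.1 _ hv)).trans ?_
          gcongr
          exact hdev N hN a ha _ hv)
        (fun a ha η => by
          have hv := indicators_mem_stdSimplex η
          refine (average_abs_rate_le hL hD hB hN0 hv (h𝒟 N a ha.1.1 _ hv) η).trans ?_
          rw [hC]
          gcongr
          exact (hdev N hN a ha _ hv).trans (hR0 N hN).2)
        (fun v hv v' hv' => norm_drift_sub_le hL0 hB0 hL hD hB hv hv') hNr.le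
      -- Four causes of failure: environments outside `D`, a graph that is not nearly homogeneous, a
      -- bad initial value, and large fluctuations of the chain on a good graph.
      refine le_trans (measure_mono ?_) ((measure_union_le _ _).trans (add_le_add
        ((measure_union_le _ _).trans (add_le_add (measure_union_le _ _) le_rfl)) hc))
      intro ω hω
      by_contra hcon
      simp only [Set.mem_union, not_or] at hcon
      obtain ⟨⟨⟨h1, h2⟩, h3⟩, h4⟩ := hcon
      exact h4 ⟨hmem N ω (not_not.1 h1) (not_not.1 h2), not_not.1 h3, hω⟩
    · have hsum := (h𝒟P.add hnh).add (hy0.tendsto_prob_norm hδ0)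
      simp only [add_zero] at hsum
      refine tendsto_of_tendsto_of_tendsto_of_le_of_le' tendsto_const_nhds hsum
        (Eventually.of_forall fun _ => zero_le) ?_
      filter_upwards [eventually_ge_atTop 2, hRlim.eventually (gt_mem_nhds hlt)] with N hN hNr
      have hN0 : N ≠ 0 := by omega
      have hd0 : 0 ≤ avgDegree N (p N) (∫ x, x ∂ν) := by
        have hN2 : (2 : ℝ) ≤ N := by exact_mod_cast hN
        exact mul_nonneg (by linarith) (mul_nonneg (hG N).p_mem.1 hν_pos.le)
      refine le_trans (measure_mono_ae ?_) ((measure_union_le _ _).trans (add_le_add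
        (measure_union_le _ _) le_rfl))
      filter_upwards [hz N, (hG N).ae_mul_nonneg hν_nonneg] with ω hzω hnn hω
      obtain ⟨t, ht, hrt⟩ := hω
      by_contra hcon
      have h1 := not_not.1 fun h => hcon (Or.inl (Or.inl h))
      have h2 := not_not.1 fun h => hcon (Or.inl (Or.inr h))
      have h3 := not_not.1 fun h => hcon (Or.inr h)
      have hA := hmem N ω h1 h2
      have key := hzω.norm_average_sub_le hQ hQlip hL0 hB0 hL hD hB hN0 hd0 (adj_nonneg hnn) hu
        (h𝒟 N _ hA.1.1) (hR0 N hN).1 (hdev N hN _ hA) h3 ht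
      -- NIMFA has no noise, so its bound is dominated by that for the chain, and the same δ and N
      -- suffice.
      have hle : (δ + S * L * R N * T) * E ≤
          (2 * δ + T * (2 * (S * L * R N + (N : ℝ)⁻¹))) * E := by
        refine mul_le_mul_of_nonneg_right ?_ hE0.le
        have h5 : 0 ≤ S * L * R N := mul_nonneg (by positivity) (hR0 N hN).1
        have h6 : 0 ≤ (N : ℝ)⁻¹ := by positivity
        nlinarith [mul_nonneg hT.le h5, mul_nonneg hT.le h6]
      exact absurd (hrt.trans_le (key.trans hle)) (not_lt.2 hNr.le)
  refine ⟨fun ε hε => ?_, fun ε hε => ?_⟩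
  · obtain ⟨r, hr, hsup⟩ := exists_norm_bound_of_le_supDist S hε
    exact tendsto_of_tendsto_of_tendsto_of_le_of_le tendsto_const_nhds (main r hr).1
      (fun _ => zero_le) fun N => measure_mono fun ω hω => hsup T _ _ hω
  · obtain ⟨r, hr, hsup⟩ := exists_norm_bound_of_le_supDist S hε
    exact tendsto_of_tendsto_of_tendsto_of_le_of_le tendsto_const_nhds (main r hr).2
      (fun _ => zero_le) fun N => measure_mono fun ω hω => hsup T _ _ hω

/-- The polynomial lower bound on the average degree makes `N * p N ^ 2` tend to infinity. -/
theorem tendsto_mul_sq_of_avgDegree {p : ℕ → ℝ} (hp : ∀ N, 0 ≤ p N) {μ c ε : ℝ} (hμ : 0 < μ)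
    (hc : 0 < c) (hε : 0 < ε)
    (h : ∀ᶠ N : ℕ in atTop, c * (N : ℝ) ^ ((1 : ℝ) / 2 + ε) ≤ avgDegree N (p N) μ) :
    Tendsto (fun N : ℕ => (N : ℝ) * p N ^ 2) atTop atTop := by
  -- A lower bound for Np²: square c N^(1/2+ε) ≤ N p μ and divide by N μ².
  have hlim : Tendsto (fun N : ℕ => (c / μ) ^ 2 * (N : ℝ) ^ (2 * ε)) atTop atTop :=
    ((tendsto_rpow_atTop (by positivity)).comp tendsto_natCast_atTop_atTop).const_mul_atTop
      (by positivity)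
  refine tendsto_atTop_mono' _ ?_ hlim
  filter_upwards [h, eventually_ge_atTop 1] with N hN hN1
  have hN0 : (0 : ℝ) < N := by exact_mod_cast hN1
  have h1 : c * (N : ℝ) ^ ((1 : ℝ) / 2 + ε) ≤ N * (p N * μ) := by
    refine hN.trans ?_
    rw [avgDegree]
    have := mul_nonneg (hp N) hμ.le
    nlinarith
  have h2 : (c * (N : ℝ) ^ ((1 : ℝ) / 2 + ε)) ^ 2 ≤ (N * (p N * μ)) ^ 2 := by gcongr
  have h3 : ((N : ℝ) ^ ((1 : ℝ) / 2 + ε)) ^ 2 = N * (N : ℝ) ^ (2 * ε) := by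
    rw [← Real.rpow_natCast, ← Real.rpow_mul hN0.le, ← Real.rpow_one_add' hN0.le (by positivity)]
    congr 1
    push_cast
    ring
  rw [mul_pow, h3] at h2
  rw [div_pow, div_mul_eq_mul_div, div_le_iff₀ (by positivity)]
  have h4 : N * (c ^ 2 * (N : ℝ) ^ (2 * ε)) ≤ N * (N * p N ^ 2 * μ ^ 2) := by
    calc _ = c ^ 2 * (N * (N : ℝ) ^ (2 * ε)) := by ring
      _ ≤ _ := h2
      _ = _ := by ring
  exact le_of_mul_le_mul_left h4 hN0

-- Bounded degrees under an exponential moment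

/-- The nonnegative matrices whose row sums are at most `c`. -/
def boundedDegree (N : ℕ) (c : ℝ) : Set (Fin N → Fin N → ℝ) :=
  {a | (∀ i j, 0 ≤ a i j) ∧ ∀ i, ∑ j, a i j ≤ c}

theorem measurableSet_boundedDegree (N : ℕ) (c : ℝ) : MeasurableSet (boundedDegree N c) := by
  have h : boundedDegree N c = (⋂ i, ⋂ j, {a | 0 ≤ a i j}) ∩ ⋂ i, {a | ∑ j, a i j ≤ c} := by
    ext; simp [boundedDegree]
  rw [h]
  refine (MeasurableSet.iInter fun i => MeasurableSet.iInter fun j => ?_).inter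
    (MeasurableSet.iInter fun i => ?_)
  · have hm : Measurable fun a : Fin N → Fin N → ℝ => a i j := by fun_prop
    exact measurableSet_le measurable_const hm
  · have hm : Measurable fun a : Fin N → Fin N → ℝ => ∑ j, a i j := by fun_prop
    exact measurableSet_le hm measurable_const

theorem environment_mem_Icc_of_mem_boundedDegree {N S : ℕ} {d K : ℝ} (hd : 0 ≤ d) (hK : 0 ≤ K)
    {a : Fin N → Fin N → ℝ} (ha : a ∈ boundedDegree N (K * d)) {v : Fin N → Fin S → ℝ}
    (hv : ∀ i, v i ∈ stdSimplex ℝ (Fin S)) (i : Fin N) :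
    environment d a v i ∈ Set.Icc (0 : Fin S → ℝ) (fun _ => K) := by
  refine ⟨fun s => environment_nonneg hd ha.1 (fun j => (hv j).1) i s, fun s => ?_⟩
  rw [environment_apply]
  have h1 : ∑ j, a i j * v j s ≤ K * d := by
    refine le_trans (Finset.sum_le_sum fun j _ => ?_) (ha.2 i)
    exact mul_le_of_le_one_right (ha.1 i j)
      ((le_abs_self _).trans (abs_le_one_of_mem_stdSimplex (hv j) s))
  -- For d = 0 (for instance N = 1) the convention 0⁻¹ = 0 makes the environment zero.
  rcases hd.eq_or_lt with rfl | hd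
  · simpa using hK
  · rw [inv_mul_le_iff₀ hd, mul_comm]
    exact h1

/-- On the complete graph with exponentially integrable weights, all degrees are bounded by a
multiple of the average degree, with high probability. -/
theorem exists_tendsto_prob_not_boundedDegree {Ω : ℕ → Type*} [∀ N, MeasurableSpace (Ω N)]
    {P : ∀ N, Measure (Ω N)} [∀ N, IsProbabilityMeasure (P N)] {ν : Measure ℝ}
    (hν : ∀ᵐ x ∂ν, 0 ≤ x) (hμ : 0 < ∫ x, x ∂ν) {w b : ∀ N, Edge N → Ω N → ℝ}
    (hG : ∀ N, IsWeightedErdosRenyi (P N) ν 1 (w N) (b N)) {θ : ℝ} (hθ : 0 < θ)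
    (h_int : Integrable (fun x => Real.exp (θ * x)) ν) :
    ∃ K : ℝ, 1 ≤ K ∧ Tendsto (fun N => P N {ω | adj (fun e => w N e ω) (fun e => b N e ω) ∉
      boundedDegree N (K * avgDegree N 1 (∫ x, x ∂ν))}) atTop (𝓝 0) := by
  set μ := ∫ x, x ∂ν with hμdef
  set m := max 1 (∫ x, Real.exp (θ * x) ∂ν) with hm
  have hm1 : 1 ≤ m := le_max_left _ _
  have hlog : 0 ≤ Real.log m := Real.log_nonneg hm1
  -- The Chernoff exponent is -θK(N - 1)μ + N log m, and N - 1 ≥ N/2, so this K makes it at most -N.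
  -- The maximum with 1 lets the box [0, K]^S contain the simplex.
  set K := max 1 (2 * (Real.log m + 1) / (θ * μ)) with hK
  have hKle : 2 * (Real.log m + 1) ≤ K * (θ * μ) := by
    rw [← div_le_iff₀ (by positivity)]
    exact le_max_right _ _
  refine ⟨K, le_max_left _ _, ?_⟩
  have hlim : Tendsto (fun N : ℕ => ENNReal.ofReal (N * Real.exp (-(N : ℝ)))) atTop (𝓝 0) := by
    have h1 := (Real.tendsto_pow_mul_exp_neg_atTop_nhds_zero 1).comp tendsto_natCast_atTop_atTop
    have h2 := ENNReal.tendsto_ofReal h1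
    simpa [Function.comp_def] using h2
  refine tendsto_of_tendsto_of_tendsto_of_le_of_le' tendsto_const_nhds hlim
    (Eventually.of_forall fun _ => zero_le) ?_
  filter_upwards [eventually_ge_atTop 2] with N hN
  have hN2 : (2 : ℝ) ≤ N := by exact_mod_cast hN
  refine le_trans (measure_mono_ae ?_) (((hG N).prob_large_degree hθ h_int
    (K * avgDegree N 1 μ)).trans (ENNReal.ofReal_le_ofReal ?_))
  · filter_upwards [(hG N).ae_mul_nonneg hν] with ω hω hnot
    by_contra hcon
    refine hnot ⟨adj_nonneg hω, fun i => ?_⟩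
    by_contra hi
    exact hcon ⟨i, not_le.1 hi⟩
  · gcongr
    have hpow : m ^ N = Real.exp (N * Real.log m) := by
      rw [Real.exp_nat_mul, Real.exp_log (by positivity)]
    rw [← hm, hpow, ← Real.exp_add]
    refine Real.exp_le_exp.2 ?_
    have h1 : θ * (K * avgDegree N 1 μ) = ((N : ℝ) - 1) * (K * (θ * μ)) := by
      rw [avgDegree]; ring
    have h2 : ((N : ℝ) - 1) * (2 * (Real.log m + 1)) ≤ ((N : ℝ) - 1) * (K * (θ * μ)) := by
      gcongr
      linarith
    nlinarith

end MeanField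

-- The theorem

theorem theorem2 {S : ℕ}
    -- the rate functions, locally Lipschitz
    (Q : (Fin S → ℝ) → Matrix (Fin S) (Fin S) ℝ) (hQ : IsRateFunction Q)
    (hQlip : ∀ k s, LocallyLipschitz fun φ => Q φ k s)
    -- the law of the weights: nonnegative, with positive finite mean and finite variance
    (ν : Measure ℝ) [IsProbabilityMeasure ν] (hν_nonneg : ∀ᵐ x ∂ν, 0 ≤ x)
    (hν_memLp : MemLp id 2 ν) (hν_pos : 0 < ∫ x, x ∂ν)
    -- the weighted Erdős–Rényi graphs
    (p : ℕ → ℝ) {Ω : ℕ → Type*} [∀ N, MeasurableSpace (Ω N)] (P : ∀ N, Measure (Ω N))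
    [∀ N, IsProbabilityMeasure (P N)] (w b : ∀ N, Edge N → Ω N → ℝ)
    (hG : ∀ N, IsWeightedErdosRenyi (P N) ν (p N) (w N) (b N))
    -- the local density-dependent Markov processes on them
    (ξ : ∀ N, ℝ → Ω N → Config N S)
    (hξ : ∀ N, IsLocalDensityProcess (P N) Q (avgDegree N (p N) (∫ x, x ∂ν))
      (fun ω => adj (fun e => w N e ω) (fun e => b N e ω)) (ξ N))
    -- the NIMFA approximations
    (z : ∀ N, Ω N → ℝ → Fin N → Fin S → ℝ)
    (hz : ∀ N, ∀ᵐ ω ∂(P N), IsNIMFA Q (avgDegree N (p N) (∫ x, x ∂ν))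
      (adj (fun e => w N e ω) (fun e => b N e ω)) (z N ω))
    -- the homogeneous mean-field approximation
    (u : ℝ → Fin S → ℝ) (hu : IsMeanFieldSolution Q u)
    -- convergence of the initial conditions
    (hx0 : TendstoZeroInProbability P fun N ω => dist1 (average (indicators (ξ N 0 ω))) (u 0))
    (hy0 : TendstoZeroInProbability P fun N ω => dist1 (average (z N ω 0)) (u 0))
    -- either (A1 and A2) or (B1 and B2)
    (hAB :
      ((∀ k s, ∃ L, LipschitzWith L fun φ => Q φ k s) ∧
        ∃ c > 0, ∃ ε > 0, ∀ᶠ N : ℕ in atTop,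
          c * (N : ℝ) ^ ((1 : ℝ) / 2 + ε) ≤ avgDegree N (p N) (∫ x, x ∂ν)) ∨
      ((∀ N, p N = 1) ∧ ∃ θ > 0, Integrable (fun x => Real.exp (θ * x)) ν)) :
    ∀ T > 0,
      TendstoZeroInProbability P
        (fun N ω => supDist T (fun t => average (indicators (ξ N t ω))) u) ∧
      TendstoZeroInProbability P
        (fun N ω => supDist T (fun t => average (z N ω t)) u) := by
  intro T hT
  rcases hAB with ⟨hlip, c, hc, ε, hε, hdeg⟩ | ⟨hp1, θ, hθ, h_int⟩
  -- Globally Lipschitz rates: no restriction on the environments or the degrees is needed.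
  · obtain ⟨L, hL0, hL⟩ := exists_lipschitzRates (Q := Q) (D := Set.univ) fun k s =>
      (hlip k s).imp fun K hK => hK.lipschitzOnWith
    refine tendstoZeroInProbability_of_lipschitzRates hQ hQlip hν_nonneg hν_memLp hν_pos hG hξ hz hu
      hx0 hy0 hL0 hL (Set.subset_univ _) (𝒟 := fun _ => Set.univ) (fun _ => MeasurableSet.univ)
      (fun _ _ _ _ _ _ => Set.mem_univ _) (by simp)
      (tendsto_mul_sq_of_avgDegree (fun N => (hG N).p_mem.1) hν_pos hc hε hdeg) hT
  · obtain rfl : p = fun _ => 1 := funext hp1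
    obtain ⟨K, hK1, hK⟩ := exists_tendsto_prob_not_boundedDegree hν_nonneg hν_pos hG hθ h_int
    have hK0 : 0 ≤ K := zero_le_one.trans hK1
    -- Locally Lipschitz rates are Lipschitz on the compact box [0, K]^S, which contains all
    -- environments when the degrees are at most K⟨d⟩.
    obtain ⟨L, hL0, hL⟩ := exists_lipschitzRates_of_isCompact hQlip
      (isCompact_Icc (a := (0 : Fin S → ℝ)) (b := fun _ => K))
    refine tendstoZeroInProbability_of_lipschitzRates hQ hQlip hν_nonneg hν_memLp hν_pos hG hξ hz hu
      hx0 hy0 hL0 hL (fun v hv => ⟨hv.1, fun s => ?_⟩)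
      (fun N => measurableSet_boundedDegree N _) (fun N a ha v hv i => ?_) hK
      (by simpa using tendsto_natCast_atTop_atTop) hT
    · exact ((le_abs_self _).trans (abs_le_one_of_mem_stdSimplex hv s)).trans hK1
    · refine environment_mem_Icc_of_mem_boundedDegree ?_ hK0 ha hv i
      -- The vertex i forces N ≥ 1; for N = 0 the factor N - 1 of the average degree would be
      -- negative.
      have hN : (1 : ℝ) ≤ N := by exact_mod_cast i.pos
      exact mul_nonneg (by linarith) (by positivity)
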